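/- **Setting.** For prices $(p,q)\in[0,1]^2$ and valuations $(s,b)\in[0,1]^2$ let $\mathsf{GFT}(p,q,s,b)=(b-s)\,\mathbb I(b\ge q,\,s\le p)$ and $\mathsf{Rev}(p,q,s,b)=(q-p)\,\mathbb I(b\ge q,\,s\le p)$. Let $\mathcal A\subset[0,1]^2$ be a non-empty finite set of price pairs, $\mathcal A_s=\{p:(p,q)\in\mathcal A\}$, $\mathcal A_b=\{q:(p,q)\in\mathcal A\}$. In each round $t=1,\dots,T$ the environment fixes valuations $(s_t,b_t)\in[0,1]^2$ and a multiplier $\lambda_t\in\mathbb R$, at random or deterministically, possibly depending on everything that happened in rounds $1,\dots,t-1$, but (given that past) independently of the algorithm's random choices of round $t$. In particular $(s_t,b_t)$ may be drawn independently from distributions $\mathcal L_t$ fixed in advance, while $\lambda_t$ is a function of the past. Write $\mathsf{GFT}_t(p,q)=\mathsf{GFT}(p,q,s_t,b_t)$ and $\mathsf{Rev}_t(p,q)=\mathsf{Rev}(p,q,s_t,b_t)$. **Algorithm** with parameters $\mathcal A$, $\eta>0$, $\gamma>0$, $\alpha\in(0,1]$. Put $w_1\equiv 1$ on $\mathcal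 A$. In round $t$ let $\hat\pi_t(p,q)=w_t(p,q)/\sum_{(p',q')\in\mathcal A}w_t(p',q')$. Given the past, draw independently $(\hat p_t,\hat q_t)\sim\hat\pi_t$, $H_t\in\{0,1,2\}$ with probabilities $1-\alpha,\alpha/2,\alpha/2$, and $U_t,V_t$ uniform on $[0,1]$. Post $(p_t,q_t)=(\hat p_t,\hat q_t)$ if $H_t=0$, $(U_t,\hat q_t)$ if $H_t=1$, $(\hat p_t,V_t)$ if $H_t=2$. Observe $\mathbb I(s_t\le p_t,\,b_t\ge q_t)$ and $\lambda_t$, and for $(p,q)\in\mathcal A$ set $$\tilde\ell_t(p,q)=\begin{cases}\dfrac{1-\mathbb I(s_t\le U_t\le p,\ b_t\ge q)}{\frac\alpha2\sum_{p':(p',q)\in\mathcal A}\hat\pi_t(p',q)+\gamma}& q=\hat q_t,\ H_t=1,\\[2ex] \dfrac{1-\mathbb I(s_t\le p,\ b_t\ge V_t\ge q)}{\frac\alpha2\sum_{q':(p,q')\in\mathcal A}\hat\pi_t(p,q')+\gamma}& p=\hat p_t,\ H_t=2,\\[2ex] \dfrac{(1+\lambda_t)\bigl(1-\mathsf{Rev}_t(p_t,q_t)\bigr)}{(1-\alpha)\hat\pi_t(p,q)+\gamma}&(p,q)=(\hat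 p_t,\hat q_t),\ H_t=0,\\[1ex] 0&\text{otherwise,}\end{cases}$$ and $w_{t+1}(p,q)=w_t(p,q)\exp(-\eta\,\tilde\ell_t(p,q))$. **Theorem.** There are absolute constants $C>0$ and $k\in\mathbb N$ such that for every non-empty finite $\mathcal A\subset[0,1]^2$, every $T\ge2$, every $\alpha\in(0,1]$ and every $M\ge1$ there are $\eta,\gamma>0$ (depending only on $\mathcal A,T,\alpha,M$) such that, against every environment as above, with probability at least $1-C/T$ the following holds simultaneously for all $\tau\le T$ with $0\le\lambda_t\le M$ for all $t\le\tau$, and for all probability distributions $\pi$ on $\mathcal A$: $$\sum_{t=1}^{\tau}\sum_{(p,q)\in\mathcal A}\pi(p,q)\bigl(\mathsf{GFT}_t(p,q)+\lambda_t\mathsf{Rev}_t(p,q)\bigr)-\sum_{t=1}^{\tau}\bigl(\mathsf{GFT}_t(p_t,q_t)+\lambda_t\mathsf{Rev}_t(p_t,q_t)\bigr)\le C(\log T)^k\,M\left(\sqrt{|\mathcal A|T}+\frac{|\mathcal A_s|+|\mathcal A_b|}{\sqrt{|\mathcal A|}}\cdot\frac{\sqrt T}{\alpha}+\alpha T\right).$$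 -/

import Mathlib

open MeasureTheory ProbabilityTheory unitInterval

noncomputable section

namespace BilateralTrade

/-- Gain from trade of the prices `x = (p, q)` at the valuations `v = (s, b)`:
`(b - s) * 𝟙(b ≥ q, s ≤ p)`. -/
def gft (x v : I × I) : ℝ :=
  if x.2 ≤ v.2 ∧ v.1 ≤ x.1 then (v.2 : ℝ) - v.1 else 0

/-- Revenue of the prices `x = (p, q)` at the valuations `v = (s, b)`:
`(q - p) * 𝟙(b ≥ q, s ≤ p)`. -/
def rev (x v : I × I) : ℝ :=
  if x.2 ≤ v.2 ∧ v.1 ≤ x.1 then (x.2 : ℝ) - x.1 else 0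

/-- What the environment fixes in one round: the valuations `(s_t, b_t)` and the
Lagrange multiplier `lam_t`. -/
abbrev EnvMove : Type := (I × I) × ℝ

/-- The random choices of the algorithm in one round: the pair `(p̂_t, q̂_t)`, the
exploration flag `H_t`, and the uniform prices `(U_t, V_t)`. -/
abbrev Draw : Type := (I × I) × Fin 3 × (I × I)

/-- Everything that happens in one round. -/
abbrev Round : Type := EnvMove × Draw

/-- The valuations `(s_t, b_t)`. -/
def val (r : Round) : I × I := r.1.1

/-- The multiplier `lam_t`. -/
def mult (r : Round) : ℝ := r.1.2

/-- The sampled pair `(p̂_t, q̂_t)`. -/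
def hat (r : Round) : I × I := r.2.1

/-- The exploration flag `H_t`. -/
def flag (r : Round) : Fin 3 := r.2.2.1

/-- The uniform seller price `U_t`. -/
def unifS (r : Round) : I := r.2.2.2.1

/-- The uniform buyer price `V_t`. -/
def unifB (r : Round) : I := r.2.2.2.2

/-- The posted prices `(p_t, q_t)`. -/
def posted (r : Round) : I × I :=
  if flag r = 0 then hat r
  else if flag r = 1 then (unifS r, (hat r).2)
  else ((hat r).1, unifB r)

/-- The loss estimator at the pair `a = (p, q)`, where `ρ` is the sampling distribution of
the round. It uses the valuations only through the trade indicator at the posted prices. -/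
def lossEst (A : Finset (I × I)) (α γ : ℝ) (ρ : I × I → ℝ) (r : Round) (a : I × I) : ℝ :=
  if a.2 = (hat r).2 ∧ flag r = 1 then
    (1 - (if (val r).1 ≤ unifS r ∧ unifS r ≤ a.1 ∧ a.2 ≤ (val r).2 then 1 else 0)) /
      (α / 2 * (∑ x ∈ A with x.2 = a.2, ρ x) + γ)
  else if a.1 = (hat r).1 ∧ flag r = 2 then
    (1 - (if (val r).1 ≤ a.1 ∧ unifB r ≤ (val r).2 ∧ a.2 ≤ unifB r then 1 else 0)) /
      (α / 2 * (∑ x ∈ A with x.1 = a.1, ρ x) + γ)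
  else if a = hat r ∧ flag r = 0 then
    (1 + mult r) * (1 - rev (posted r) (val r)) / ((1 - α) * ρ a + γ)
  else 0

/-- The distribution on `A` proportional to the weights `w`. -/
def normalize (A : Finset (I × I)) (w : I × I → ℝ) (a : I × I) : ℝ :=
  w a / ∑ x ∈ A, w x

/-- The weights after the `n` rounds recorded in the history: all equal to `1` at the start,
then multiplied by `exp (-η * loss estimate)` in each round. -/
def weight (A : Finset (I × I)) (η γ α : ℝ) : (n : ℕ) → (Fin n → Round) → I × I → ℝ
  | 0, _, _ => 1
  | n + 1, h, a =>
      weight A η γ α n (Fin.init h) a *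
        Real.exp (-η * lossEst A α γ (normalize A (weight A η γ α n (Fin.init h)))
          (h (Fin.last n)) a)

/-- The sampling distribution used in the round that follows the history. -/
def sampling (A : Finset (I × I)) (η γ α : ℝ) (n : ℕ) (h : Fin n → Round) : I × I → ℝ :=
  normalize A (weight A η γ α n h)

lemma measurable_val : Measurable val := by unfold val; fun_prop
lemma measurable_mult : Measurable mult := by unfold mult; fun_prop
lemma measurable_hat : Measurable hat := by unfold hat; fun_prop
lemma measurable_flag : Measurable flag := by unfold flag; fun_prop
lemma measurable_unifS : Measurable unifS := by unfold unifS; fun_prop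
lemma measurable_unifB : Measurable unifB := by unfold unifB; fun_prop

lemma measurable_posted : Measurable posted := by
  unfold posted
  have h1 := measurable_hat
  have h2 := measurable_unifS
  have h3 := measurable_unifB
  refine Measurable.ite (measurable_flag (measurableSet_singleton 0)) h1
    (Measurable.ite (measurable_flag (measurableSet_singleton 1)) ?_ ?_) <;> fun_prop

lemma measurable_rev_posted : Measurable fun r : Round => rev (posted r) (val r) := by
  unfold rev
  have h1 := measurable_posted
  have h2 := measurable_val
  refine Measurable.ite ((measurableSet_le ?_ ?_).inter (measurableSet_le ?_ ?_)) ?_ ?_ <;>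
    fun_prop

lemma measurable_lossEst {X : Type*} [MeasurableSpace X] (A : Finset (I × I)) (α γ : ℝ)
    (a : I × I) {ρ : X → I × I → ℝ} (hρ : ∀ b, Measurable fun x => ρ x b)
    {r : X → Round} (hr : Measurable r) :
    Measurable fun x => lossEst A α γ (ρ x) (r x) a := by
  unfold lossEst
  have h1 := measurable_val.comp hr
  have h2 := measurable_unifS.comp hr
  have h3 := measurable_unifB.comp hr
  have h4 := measurable_hat.comp hr
  have h5 := measurable_flag.comp hr
  have h6 := measurable_mult.comp hr
  have h7 := measurable_rev_posted.comp hr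
  simp only [Function.comp_def] at h1 h2 h3 h4 h5 h6 h7
  have hs : ∀ i : Fin 3, MeasurableSet {x | flag (r x) = i} := fun i =>
    h5 (measurableSet_singleton i)
  refine Measurable.ite ((measurableSet_eq_fun (by fun_prop) (by fun_prop)).inter (hs 1)) ?_
    (Measurable.ite ((measurableSet_eq_fun (by fun_prop) (by fun_prop)).inter (hs 2)) ?_
      (Measurable.ite ((measurableSet_eq_fun (by fun_prop) (by fun_prop)).inter (hs 0)) ?_
        measurable_const))
  · refine Measurable.div (measurable_const.sub (Measurable.ite ?_ measurable_const
      measurable_const)) (by fun_prop)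
    exact (measurableSet_le (by fun_prop) (by fun_prop)).inter
      ((measurableSet_le (by fun_prop) (by fun_prop)).inter
        (measurableSet_le (by fun_prop) (by fun_prop)))
  · refine Measurable.div (measurable_const.sub (Measurable.ite ?_ measurable_const
      measurable_const)) (by fun_prop)
    exact (measurableSet_le (by fun_prop) (by fun_prop)).inter
      ((measurableSet_le (by fun_prop) (by fun_prop)).inter
        (measurableSet_le (by fun_prop) (by fun_prop)))
  · fun_prop

lemma measurable_init (n : ℕ) :
    Measurable fun h : Fin (n + 1) → Round => (Fin.init h : Fin n → Round) :=
  measurable_pi_lambda _ fun i => measurable_pi_apply i.castSucc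

lemma measurable_weight (A : Finset (I × I)) (η γ α : ℝ) :
    ∀ (n : ℕ) (a : I × I), Measurable fun h => weight A η γ α n h a
  | 0, _ => measurable_const
  | n + 1, a => by
    have ih : ∀ b, Measurable fun h : Fin (n + 1) → Round =>
        weight A η γ α n (Fin.init h) b :=
      fun b => (measurable_weight A η γ α n b).comp (measurable_init n)
    have hl := measurable_lossEst A α γ a
      (ρ := fun h : Fin (n + 1) → Round => normalize A (weight A η γ α n (Fin.init h)))
      (fun b => (ih b).div (Finset.measurable_sum _ fun x _ => ih x))
      (measurable_pi_apply (Fin.last n))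
    exact (ih a).mul (Real.measurable_exp.comp (hl.const_mul (-η)))

lemma measurable_sampling (A : Finset (I × I)) (η γ α : ℝ) (n : ℕ) (a : I × I) :
    Measurable fun h => sampling A η γ α n h a :=
  (measurable_weight A η γ α n a).div
    (Finset.measurable_sum _ fun x _ => measurable_weight A η γ α n x)

/-- The conditional law of `(p̂_t, q̂_t)` given the history. -/
def hatKernel (A : Finset (I × I)) (η γ α : ℝ) (n : ℕ) :
    Kernel (Fin n → Round) (I × I) where
  toFun h := ∑ a ∈ A, ENNReal.ofReal (sampling A η γ α n h a) • Measure.dirac a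
  measurable' := by
    refine Measure.measurable_of_measurable_coe _ fun s _ => ?_
    simp only [Measure.coe_finsetSum, Finset.sum_apply, Measure.smul_apply, smul_eq_mul]
    exact Finset.measurable_sum _ fun a _ =>
      (measurable_sampling A η γ α n a).ennreal_ofReal.mul_const _

/-- The law of `H_t`: the values `0, 1, 2` have probability `1 - α, α / 2, α / 2`. -/
def flagLaw (α : ℝ) : Measure (Fin 3) :=
  ENNReal.ofReal (1 - α) • Measure.dirac 0 + ENNReal.ofReal (α / 2) • Measure.dirac 1 +
    ENNReal.ofReal (α / 2) • Measure.dirac 2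

/-- The conditional law of the algorithm's random choices given the history:
`(p̂_t, q̂_t)`, `H_t`, `U_t`, `V_t` are independent. -/
def drawKernel (A : Finset (I × I)) (η γ α : ℝ) (n : ℕ) : Kernel (Fin n → Round) Draw :=
  hatKernel A η γ α n ×ₖ
    Kernel.const _ ((flagLaw α).prod ((volume : Measure I).prod (volume : Measure I)))

/-- The law of the first `n` rounds when the algorithm with parameters `A, η, γ, α` plays
against the environment `env`. In each round, given the history, the environment's choice of
valuations and multiplier is independent of the algorithm's random choices of that round. -/
def law (A : Finset (I × I)) (η γ α : ℝ)
    (env : (n : ℕ) → Kernel (Fin n → Round) EnvMove) : (n : ℕ) → Measure (Fin n → Round)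
  | 0 => Measure.dirac Fin.elim0
  | n + 1 => (law A η γ α env n ⊗ₘ (env n ×ₖ drawKernel A η γ α n)).map
      fun x => (Fin.snoc x.1 x.2 : Fin (n + 1) → Round)

/-- The law of the rounds is a probability measure. -/
lemma isProbabilityMeasure_law {A : Finset (I × I)} (hA : A.Nonempty) (η γ : ℝ) {α : ℝ}
    (h0 : 0 ≤ α) (h1 : α ≤ 1) (env : (n : ℕ) → Kernel (Fin n → Round) EnvMove)
    (henv : ∀ n, IsMarkovKernel (env n)) (n : ℕ) :
    IsProbabilityMeasure (law A η γ α env n) := by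
  have hflag : IsProbabilityMeasure (flagLaw α) := ⟨by
    simp only [flagLaw, Measure.coe_add, Pi.add_apply, Measure.smul_apply, smul_eq_mul,
      measure_univ, mul_one]
    rw [← ENNReal.ofReal_add (by linarith) (by linarith),
      ← ENNReal.ofReal_add (by linarith) (by linarith)]
    rw [show 1 - α + α / 2 + α / 2 = 1 by ring, ENNReal.ofReal_one]⟩
  have hpos : ∀ (n : ℕ) (h : Fin n → Round) (a : I × I), 0 < weight A η γ α n h a := by
    intro n
    induction n with
    | zero => intro h a; exact one_pos
    | succ n ih => intro h a; exact mul_pos (ih _ _) (Real.exp_pos _)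
  have hhat : ∀ n, IsMarkovKernel (hatKernel A η γ α n) := fun n => ⟨fun h => ⟨by
    have hs : 0 < ∑ x ∈ A, weight A η γ α n h x := Finset.sum_pos (fun x _ => hpos n h x) hA
    change (∑ a ∈ A, ENNReal.ofReal (sampling A η γ α n h a) • Measure.dirac a) Set.univ = 1
    simp only [Measure.coe_finsetSum, Finset.sum_apply, Measure.smul_apply, smul_eq_mul,
      measure_univ, mul_one]
    have hnn : ∀ a ∈ A, 0 ≤ sampling A η γ α n h a :=
      fun a _ => div_nonneg (hpos n h a).le hs.le
    rw [← ENNReal.ofReal_sum_of_nonneg hnn]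
    simp only [sampling, normalize]
    rw [← Finset.sum_div, div_self hs.ne', ENNReal.ofReal_one]⟩⟩
  have hdraw : ∀ n, IsMarkovKernel (drawKernel A η γ α n) := fun n => by
    have := hhat n
    unfold drawKernel
    infer_instance
  induction n with
  | zero => exact Measure.dirac.isProbabilityMeasure
  | succ n ih =>
    have := henv n
    have := hdraw n
    refine Measure.isProbabilityMeasure_map (Measurable.aemeasurable ?_)
    refine measurable_pi_lambda _ fun i => ?_
    refine Fin.lastCases ?_ (fun j => ?_) i
    · simp only [Fin.snoc_last]
      exact measurable_snd
    · simp only [Fin.snoc_castSucc]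
      exact (measurable_pi_apply j).comp measurable_fst

/-- The reward `GFT_t + lam_t * Rev_t` of the prices `x` in the round `r`. -/
def lagrangian (r : Round) (x : I × I) : ℝ :=
  gft x (val r) + mult r * rev x (val r)

/-- The regret over the first `τ` rounds against the distribution `π` on `A`. -/
def regret (A : Finset (I × I)) {T : ℕ} (ω : Fin T → Round) (τ : ℕ) (π : I × I → ℝ) : ℝ :=
  ∑ t : Fin T with t.val < τ, ∑ x ∈ A, π x * lagrangian (ω t) x -
    ∑ t : Fin T with t.val < τ, lagrangian (ω t) (posted (ω t))

/-- The set `A_s` of seller prices of `A`. -/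
def sellerPrices (A : Finset (I × I)) : Finset I := A.image Prod.fst

/-- The set `A_b` of buyer prices of `A`. -/
def buyerPrices (A : Finset (I × I)) : Finset I := A.image Prod.snd

end BilateralTrade

end

noncomputable section

namespace BilateralTrade

/-! ### Sampling distribution -/

/-! The Lagrangian reward splits into three losses with values observable from one bit: `lossS +
lossB + lossR = 3 + λ - reward`. A uniform seller price `U` falls in `[s, p]` with probability `(p -
s)⁺`, so under `H = 1` the trade bit is an unbiased sample of the seller part, for every pair with
buyer price `q̂`. The buyer part is symmetric under `H = 2`. The revenue part is known when the
posted pair is `(p̂, q̂)` itself. Sharing observations along rows and columns makes the variance of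
the first two parts scale with `(|A_s| + |A_b|) / α` instead of `|A| / α`; only the revenue part
pays `|A|`, without the factor `1 / α`.

The regret against a fixed pair `x` telescopes into four differences: estimated minus true loss of
`x`, true minus estimated mean loss of the algorithm, estimated regret, and mean reward under the
sampling distribution minus posted reward. The third is bounded deterministically by exponential
weights (`sum_normalize_sub_le`), up to a sum of squared estimates. The other differences and that
sum are controlled by exponential supermartingales: if `X ≤ 1` and `E X + E X² ≤ m`, then `E exp (X
- m) ≤ 1` (`lintegral_exp_sub_le_one`), these bounds multiply along the play
(`lintegral_exp_total_le_one`), and Markov's inequality gives tails `exp (-u)`.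

For a single `x` the second moment of the estimator may be large, but the bias created by `γ`
absorbs it (`drawMean_lossEst_add_sq_le`). Averaged over the sampling distribution, bias and second
moment are bounded by `sum_div_prob_le`.

With `u = 4 log T`, a union bound over the pairs, the other three processes and all `τ ≤ T` fails
with probability `O(1 / T²)`. Regret is linear in `π`, so single pairs suffice. The cases `α > 1/2`
and `T ≤ |A|` follow from the trivial linear bound. -/

lemma weight_pos (A : Finset (I × I)) (η γ α : ℝ) :
    ∀ (n : ℕ) (h : Fin n → Round) (a : I × I), 0 < weight A η γ α n h a
  | 0, _, _ => one_pos
  | n + 1, _, a => mul_pos (weight_pos A η γ α n _ a) (Real.exp_pos _)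

lemma sampling_pos {A : Finset (I × I)} (hA : A.Nonempty) (η γ α : ℝ) (n : ℕ)
    (h : Fin n → Round) (a : I × I) : 0 < sampling A η γ α n h a :=
  div_pos (weight_pos A η γ α n h a)
    (Finset.sum_pos (fun x _ => weight_pos A η γ α n h x) hA)

lemma sum_sampling {A : Finset (I × I)} (hA : A.Nonempty) (η γ α : ℝ) (n : ℕ)
    (h : Fin n → Round) : ∑ a ∈ A, sampling A η γ α n h a = 1 := by
  have hs : 0 < ∑ x ∈ A, weight A η γ α n h x :=
    Finset.sum_pos (fun x _ => weight_pos A η γ α n h x) hA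
  simp only [sampling, normalize]
  rw [← Finset.sum_div, div_self hs.ne']

lemma isProbabilityMeasure_flagLaw {α : ℝ} (h0 : 0 ≤ α) (h1 : α ≤ 1) :
    IsProbabilityMeasure (flagLaw α) := ⟨by
  simp only [flagLaw, Measure.coe_add, Pi.add_apply, Measure.smul_apply, smul_eq_mul,
    measure_univ, mul_one]
  rw [← ENNReal.ofReal_add (by linarith) (by linarith),
    ← ENNReal.ofReal_add (by linarith) (by linarith)]
  rw [show 1 - α + α / 2 + α / 2 = 1 by ring, ENNReal.ofReal_one]⟩

lemma isMarkovKernel_hatKernel {A : Finset (I × I)} (hA : A.Nonempty) (η γ α : ℝ) (n : ℕ) :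
    IsMarkovKernel (hatKernel A η γ α n) := ⟨fun h => ⟨by
  change (∑ a ∈ A, ENNReal.ofReal (sampling A η γ α n h a) • Measure.dirac a) Set.univ = 1
  simp only [Measure.coe_finsetSum, Finset.sum_apply, Measure.smul_apply, smul_eq_mul,
    measure_univ, mul_one]
  rw [← ENNReal.ofReal_sum_of_nonneg fun a _ => (sampling_pos hA η γ α n h a).le,
    sum_sampling hA, ENNReal.ofReal_one]⟩⟩

lemma isMarkovKernel_drawKernel {A : Finset (I × I)} (hA : A.Nonempty) (η γ : ℝ) {α : ℝ}
    (h0 : 0 ≤ α) (h1 : α ≤ 1) (n : ℕ) : IsMarkovKernel (drawKernel A η γ α n) := by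
  have := isMarkovKernel_hatKernel hA η γ α n
  have := isProbabilityMeasure_flagLaw h0 h1
  unfold drawKernel
  infer_instance

/-! ### Expectation over the draws of one round -/

/-- Bounded measurable functions of the draws of one round. -/
def BddMeas (G : Draw → ℝ) : Prop := Measurable G ∧ ∃ K, ∀ d, |G d| ≤ K

lemma BddMeas.const (c : ℝ) : BddMeas fun _ => c := ⟨measurable_const, |c|, fun _ => le_rfl⟩

lemma BddMeas.add {F G : Draw → ℝ} (hF : BddMeas F) (hG : BddMeas G) :
    BddMeas fun d => F d + G d := by
  obtain ⟨hF, K, hK⟩ := hF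
  obtain ⟨hG, K', hK'⟩ := hG
  exact ⟨hF.add hG, K + K', fun d => (abs_add_le _ _).trans (add_le_add (hK d) (hK' d))⟩

lemma BddMeas.mul {F G : Draw → ℝ} (hF : BddMeas F) (hG : BddMeas G) :
    BddMeas fun d => F d * G d := by
  obtain ⟨hF, K, hK⟩ := hF
  obtain ⟨hG, K', hK'⟩ := hG
  refine ⟨hF.mul hG, K * K', fun d => ?_⟩
  rw [abs_mul]
  exact mul_le_mul (hK d) (hK' d) (abs_nonneg _) ((abs_nonneg _).trans (hK d))

lemma BddMeas.const_mul {G : Draw → ℝ} (c : ℝ) (hG : BddMeas G) : BddMeas fun d => c * G d :=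
  (BddMeas.const c).mul hG

lemma BddMeas.sq {G : Draw → ℝ} (hG : BddMeas G) : BddMeas fun d => G d ^ 2 := by
  simpa only [pow_two] using hG.mul hG

lemma BddMeas.sum {ι : Type*} (s : Finset ι) {G : ι → Draw → ℝ} (hG : ∀ i ∈ s, BddMeas (G i)) :
    BddMeas fun d => ∑ i ∈ s, G i d := by
  classical
  induction s using Finset.induction_on with
  | empty => simpa using BddMeas.const 0
  | insert i s hi ih =>
    simp only [Finset.sum_insert hi]
    exact (hG i (Finset.mem_insert_self i s)).add
      (ih fun j hj => hG j (Finset.mem_insert_of_mem hj))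

lemma BddMeas.exp {G : Draw → ℝ} (hG : BddMeas G) : BddMeas fun d => Real.exp (G d) := by
  obtain ⟨hG, K, hK⟩ := hG
  refine ⟨hG.exp, Real.exp K, fun d => ?_⟩
  rw [Real.abs_exp]
  exact Real.exp_le_exp.2 ((le_abs_self _).trans (hK d))

lemma BddMeas.integrable {G : Draw → ℝ} (hG : BddMeas G) (a : I × I) (i : Fin 3) :
    Integrable (fun y : I × I => G (a, i, y)) := by
  obtain ⟨hG, K, hK⟩ := hG
  exact Integrable.of_bound (hG.comp (by fun_prop)).aestronglyMeasurable K
    (Filter.Eventually.of_forall fun y => hK _)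

/-- The expectation of `G` when `(p̂, q̂)` has distribution `ρ` on `A`. -/
def drawMean (A : Finset (I × I)) (α : ℝ) (ρ : I × I → ℝ) (G : Draw → ℝ) : ℝ :=
  ∑ a ∈ A, ρ a * ((1 - α) * (∫ y, G (a, 0, y)) + α / 2 * (∫ y, G (a, 1, y)) +
    α / 2 * ∫ y, G (a, 2, y))

section drawMean

variable {A : Finset (I × I)} {α : ℝ} {ρ : I × I → ℝ}

lemma drawMean_add {F G : Draw → ℝ} (hF : BddMeas F) (hG : BddMeas G) :
    drawMean A α ρ (fun d => F d + G d) = drawMean A α ρ F + drawMean A α ρ G := by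
  simp only [drawMean, ← Finset.sum_add_distrib]
  refine Finset.sum_congr rfl fun a _ => ?_
  rw [integral_add (hF.integrable a 0) (hG.integrable a 0),
    integral_add (hF.integrable a 1) (hG.integrable a 1),
    integral_add (hF.integrable a 2) (hG.integrable a 2)]
  ring

lemma drawMean_const_mul (c : ℝ) (G : Draw → ℝ) :
    drawMean A α ρ (fun d => c * G d) = c * drawMean A α ρ G := by
  simp only [drawMean, integral_const_mul, Finset.mul_sum]
  exact Finset.sum_congr rfl fun a _ => by ring

lemma drawMean_const (hρ : ∑ a ∈ A, ρ a = 1) (c : ℝ) :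
    drawMean A α ρ (fun _ => c) = c := by
  simp only [drawMean, integral_const, probReal_univ, one_smul]
  rw [← Finset.sum_mul, hρ]
  ring

lemma drawMean_sum {ι : Type*} (s : Finset ι) {G : ι → Draw → ℝ}
    (hG : ∀ i ∈ s, BddMeas (G i)) :
    drawMean A α ρ (fun d => ∑ i ∈ s, G i d) = ∑ i ∈ s, drawMean A α ρ (G i) := by
  classical
  induction s using Finset.induction_on with
  | empty => simp [drawMean]
  | insert i s hi ih =>
    have h1 : ∀ j ∈ s, BddMeas (G j) := fun j hj => hG j (Finset.mem_insert_of_mem hj)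
    simp only [Finset.sum_insert hi]
    rw [drawMean_add (hG i (Finset.mem_insert_self i s)) (BddMeas.sum s h1), ih h1]

lemma drawMean_mono (h0 : 0 ≤ α) (h1 : α ≤ 1) (hρ : ∀ a ∈ A, 0 ≤ ρ a) {F G : Draw → ℝ}
    (hF : BddMeas F) (hG : BddMeas G) (hFG : ∀ a ∈ A, ∀ i y, F (a, i, y) ≤ G (a, i, y)) :
    drawMean A α ρ F ≤ drawMean A α ρ G := by
  refine Finset.sum_le_sum fun a ha => mul_le_mul_of_nonneg_left ?_ (hρ a ha)
  have h : ∀ i, ∫ y, F (a, i, y) ≤ ∫ y, G (a, i, y) := fun i =>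
    integral_mono (hF.integrable a i) (hG.integrable a i) (hFG a ha i)
  have h2 : 0 ≤ 1 - α := by linarith
  have h3 : 0 ≤ α / 2 := by linarith
  exact add_le_add (add_le_add (mul_le_mul_of_nonneg_left (h 0) h2)
    (mul_le_mul_of_nonneg_left (h 1) h3)) (mul_le_mul_of_nonneg_left (h 2) h3)

end drawMean

/-- The draw law is a finite mixture of Dirac masses times Lebesgue measure, so Tonelli reduces
kernel integrals to the explicit real expression `drawMean`, in which all moments are computed. -/
lemma lintegral_drawKernel {A : Finset (I × I)} (hA : A.Nonempty) (η γ : ℝ) {α : ℝ}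
    (h0 : 0 ≤ α) (h1 : α ≤ 1) (n : ℕ) (h : Fin n → Round) {G : Draw → ℝ} (hG : BddMeas G)
    (hG0 : ∀ d, 0 ≤ G d) :
    ∫⁻ d, ENNReal.ofReal (G d) ∂drawKernel A η γ α n h =
      ENNReal.ofReal (drawMean A α (sampling A η γ α n h) G) := by
  have := isMarkovKernel_hatKernel hA η γ α n
  have := isProbabilityMeasure_flagLaw h0 h1
  have hm : Measurable fun d => ENNReal.ofReal (G d) := hG.1.ennreal_ofReal
  have hI : ∀ a i, 0 ≤ ∫ y, G (a, i, y) := fun a i => integral_nonneg fun y => hG0 _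
  have h2 : 0 ≤ 1 - α := by linarith
  have h3 : 0 ≤ α / 2 := by linarith
  have hint : ∀ a i, ∫⁻ y : I × I, ENNReal.ofReal (G (a, i, y)) =
      ENNReal.ofReal (∫ y, G (a, i, y)) := fun a i =>
    (ofReal_integral_eq_lintegral_ofReal (hG.integrable a i)
      (Filter.Eventually.of_forall fun y => hG0 _)).symm
  rw [drawKernel, Kernel.prod_apply, Kernel.const_apply, lintegral_prod _ hm.aemeasurable]
  change ∫⁻ a, _ ∂(∑ a ∈ A, ENNReal.ofReal (sampling A η γ α n h a) • Measure.dirac a) = _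
  rw [lintegral_finsetSum_measure, drawMean, ENNReal.ofReal_sum_of_nonneg]
  · refine Finset.sum_congr rfl fun a _ => ?_
    have hma : Measurable fun d : Fin 3 × (I × I) => ENNReal.ofReal (G (a, d)) :=
      hm.comp measurable_prodMk_left
    rw [lintegral_smul_measure, lintegral_dirac, lintegral_prod _ hma.aemeasurable,
      smul_eq_mul, ENNReal.ofReal_mul (sampling_pos hA η γ α n h a).le]
    congr 1
    rw [flagLaw, lintegral_add_measure, lintegral_add_measure, lintegral_smul_measure,
      lintegral_smul_measure, lintegral_smul_measure, lintegral_dirac, lintegral_dirac,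
      lintegral_dirac, ENNReal.ofReal_add, ENNReal.ofReal_add, ENNReal.ofReal_mul h2,
      ENNReal.ofReal_mul h3, ENNReal.ofReal_mul h3]
    · simp only [smul_eq_mul]
      rw [← hint, ← hint, ← hint]
      rfl
    · exact mul_nonneg h2 (hI _ _)
    · exact mul_nonneg h3 (hI _ _)
    · exact add_nonneg (mul_nonneg h2 (hI _ _)) (mul_nonneg h3 (hI _ _))
    · exact mul_nonneg h3 (hI _ _)
  · intro a _
    exact mul_nonneg (sampling_pos hA η γ α n h a).le (add_nonneg (add_nonneg
      (mul_nonneg h2 (hI _ _)) (mul_nonneg h3 (hI _ _))) (mul_nonneg h3 (hI _ _)))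

/-- No lower bound on `x` is needed: below `-1` the right side already exceeds `1`. Variables of the
form `-c * X` with `X ≥ 0` thus need no boundedness relative to `c`. -/
lemma exp_le_one_add_add_sq {x : ℝ} (hx : x ≤ 1) : Real.exp x ≤ 1 + x + x ^ 2 := by
  by_cases h : -1 ≤ x
  · have := (abs_le.1 (Real.abs_exp_sub_one_sub_id_le (abs_le.2 ⟨h, hx⟩))).2
    linarith
  · have : Real.exp x ≤ 1 := Real.exp_le_one_iff.2 (by linarith)
    nlinarith

/-- A one-round exponential moment bound. -/
lemma lintegral_exp_sub_le_one {A : Finset (I × I)} (hA : A.Nonempty) (η γ : ℝ) {α : ℝ}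
    (h0 : 0 ≤ α) (h1 : α ≤ 1) (n : ℕ) (h : Fin n → Round) {X : Draw → ℝ} (hX : BddMeas X)
    (hX1 : ∀ a ∈ A, ∀ i y, X (a, i, y) ≤ 1) {m : ℝ}
    (hm : drawMean A α (sampling A η γ α n h) X +
      drawMean A α (sampling A η γ α n h) (fun d => X d ^ 2) ≤ m) :
    ∫⁻ d, ENNReal.ofReal (Real.exp (X d - m)) ∂drawKernel A η γ α n h ≤ 1 := by
  have hs := sum_sampling hA η γ α n h
  have h2 : BddMeas fun d => X d - m := by
    simpa only [sub_eq_add_neg] using hX.add (BddMeas.const (-m))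
  rw [lintegral_drawKernel hA η γ h0 h1 n h h2.exp fun d => (Real.exp_pos _).le]
  rw [ENNReal.ofReal_le_one]
  have h3 : (fun d => Real.exp (X d - m)) = fun d => Real.exp (-m) * Real.exp (X d) := by
    ext d; rw [← Real.exp_add]; ring_nf
  rw [h3, drawMean_const_mul]
  -- `E exp X ≤ 1 + E X + E X² ≤ 1 + m`, and `1 + m ≤ exp m`.
  have h4 : drawMean A α (sampling A η γ α n h) (fun d => Real.exp (X d)) ≤
      1 + m := by
    refine (drawMean_mono h0 h1 (fun a _ => (sampling_pos hA η γ α n h a).le) hX.exp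
      (((BddMeas.const 1).add hX).add hX.sq)
      fun a ha i y => exp_le_one_add_add_sq (hX1 a ha i y)).trans ?_
    rw [drawMean_add ((BddMeas.const 1).add hX) hX.sq, drawMean_add (BddMeas.const 1) hX,
      drawMean_const hs]
    linarith
  calc Real.exp (-m) * _ ≤ Real.exp (-m) * Real.exp m :=
        mul_le_mul_of_nonneg_left (h4.trans (by linarith [Real.add_one_le_exp m]))
          (Real.exp_pos _).le
    _ = 1 := by rw [← Real.exp_add]; simp

/-! ### Exponential supermartingales along the play -/

/-- The sum of `F` along a finite sequence of rounds. -/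
def total (F : (n : ℕ) → (Fin n → Round) → Round → ℝ) : (n : ℕ) → (Fin n → Round) → ℝ
  | 0, _ => 0
  | n + 1, h => total F n (Fin.init h) + F n (Fin.init h) (h (Fin.last n))

lemma total_eq_sum (F : (n : ℕ) → (Fin n → Round) → Round → ℝ) (r : ℕ → Round) (n : ℕ) :
    total F n (fun i => r i) = ∑ t ∈ Finset.range n, F t (fun i => r i) (r t) := by
  induction n with
  | zero => rfl
  | succ n ih => rw [Finset.sum_range_succ, ← ih]; rfl

lemma measurable_total {F : (n : ℕ) → (Fin n → Round) → Round → ℝ}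
    (hF : ∀ n, Measurable fun p : (Fin n → Round) × Round => F n p.1 p.2) :
    ∀ n, Measurable (total F n)
  | 0 => measurable_const
  | n + 1 => ((measurable_total hF n).comp (measurable_init n)).add
      ((hF n).comp ((measurable_init n).prodMk (measurable_pi_apply (Fin.last n))))

lemma measurable_snoc (n : ℕ) :
    Measurable fun x : (Fin n → Round) × Round => (Fin.snoc x.1 x.2 : Fin (n + 1) → Round) := by
  refine measurable_pi_lambda _ fun i => ?_
  refine Fin.lastCases ?_ (fun j => ?_) i
  · simp only [Fin.snoc_last]
    exact measurable_snd
  · simp only [Fin.snoc_castSucc]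
    exact (measurable_pi_apply j).comp measurable_fst

/-- Given the past, the environment's move and the draws are independent, so the draws can be
integrated first with the move `e` frozen. This is why `hexp` is a bound for every `e`, and why no
property of the environment enters. -/
lemma lintegral_exp_total_le_one {A : Finset (I × I)} (hA : A.Nonempty) (η γ : ℝ) {α : ℝ}
    (h0 : 0 ≤ α) (h1 : α ≤ 1) (env : (n : ℕ) → Kernel (Fin n → Round) EnvMove)
    (henv : ∀ n, IsMarkovKernel (env n)) {F : (n : ℕ) → (Fin n → Round) → Round → ℝ}
    (hF : ∀ n, Measurable fun p : (Fin n → Round) × Round => F n p.1 p.2)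
    (hexp : ∀ n h e, ∫⁻ d, ENNReal.ofReal (Real.exp (F n h (e, d))) ∂drawKernel A η γ α n h ≤ 1)
    (n : ℕ) :
    ∫⁻ ω, ENNReal.ofReal (Real.exp (total F n ω)) ∂law A η γ α env n ≤ 1 := by
  induction n with
  | zero =>
    have := isProbabilityMeasure_law hA η γ h0 h1 env henv 0
    simp [total]
  | succ n ih =>
    have := isProbabilityMeasure_law hA η γ h0 h1 env henv n
    have := isMarkovKernel_drawKernel hA η γ h0 h1 n
    have hG : Measurable fun p : (Fin n → Round) × Round =>
        ENNReal.ofReal (Real.exp (F n p.1 p.2)) := (hF n).exp.ennreal_ofReal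
    have hT : Measurable fun ω => ENNReal.ofReal (Real.exp (total F (n + 1) ω)) :=
      (measurable_total hF (n + 1)).exp.ennreal_ofReal
    have hT' : Measurable fun x : (Fin n → Round) × Round =>
        ENNReal.ofReal (Real.exp (total F (n + 1) (Fin.snoc x.1 x.2))) :=
      hT.comp (measurable_snoc n)
    rw [law, lintegral_map hT (measurable_snoc n), Measure.lintegral_compProd hT']
    refine le_trans (lintegral_mono fun h => ?_) ih
    simp only [total, Fin.init_snoc, Fin.snoc_last, Real.exp_add,
      ENNReal.ofReal_mul (Real.exp_pos _).le]
    have hGh : Measurable fun r : Round => ENNReal.ofReal (Real.exp (F n h r)) :=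
      hG.comp measurable_prodMk_left
    rw [lintegral_const_mul _ hGh, Kernel.prod_apply, lintegral_prod _ hGh.aemeasurable]
    have : ∫⁻ e, ∫⁻ d, ENNReal.ofReal (Real.exp (F n h (e, d))) ∂drawKernel A η γ α n h ∂env n h
        ≤ 1 := (lintegral_mono fun e => hexp n h e).trans (by simp)
    exact (mul_le_mul_right this _).trans (by rw [mul_one])

/-- The rounds of a finite play, continued arbitrarily. -/
def extend {T : ℕ} (ω : Fin T → Round) (t : ℕ) : Round :=
  if h : t < T then ω ⟨t, h⟩ else (((0, 0), 0), (0, 0), 0, (0, 0))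

lemma extend_coe {T : ℕ} (ω : Fin T → Round) (t : Fin T) : extend ω t = ω t := by
  simp [extend]

lemma measure_log_lt_sum_le {A : Finset (I × I)} (hA : A.Nonempty) (η γ : ℝ) {α : ℝ}
    (h0 : 0 ≤ α) (h1 : α ≤ 1) (env : (n : ℕ) → Kernel (Fin n → Round) EnvMove)
    (henv : ∀ n, IsMarkovKernel (env n)) {F : (n : ℕ) → (Fin n → Round) → Round → ℝ}
    (hF : ∀ n, Measurable fun p : (Fin n → Round) × Round => F n p.1 p.2)
    (hexp : ∀ n h e, ∫⁻ d, ENNReal.ofReal (Real.exp (F n h (e, d))) ∂drawKernel A η γ α n h ≤ 1)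
    {T τ : ℕ} (hτ : τ ≤ T) (u : ℝ) :
    (law A η γ α env T).real
      {ω | u < ∑ t ∈ Finset.range τ, F t (fun i => extend ω i) (extend ω t)} ≤
      Real.exp (-u) := by
  have := isProbabilityMeasure_law hA η γ h0 h1 env henv T
  -- Increments are switched off from round `τ` on, so sums up to any `τ ≤ T` are totals under the
  -- single law of `T` rounds, without passing to marginals.
  set F' : (n : ℕ) → (Fin n → Round) → Round → ℝ := fun n h r => if n < τ then F n h r else 0
    with hF'
  have hm : ∀ n, Measurable fun p : (Fin n → Round) × Round => F' n p.1 p.2 := by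
    intro n
    by_cases hn : n < τ
    · simpa only [hF', hn, if_true] using hF n
    · simp only [hF', hn, if_false]; exact measurable_const
  have hI := lintegral_exp_total_le_one (F := F') hA η γ h0 h1 env henv hm (fun n h e => by
    have := isMarkovKernel_drawKernel hA η γ h0 h1 n
    by_cases hn : n < τ
    · simpa only [hF', hn, if_true] using hexp n h e
    · simp [hF', hn]) T
  have heq : ∀ ω : Fin T → Round, total F' T ω =
      ∑ t ∈ Finset.range τ, F t (fun i => extend ω i) (extend ω t) := by
    intro ω
    have := total_eq_sum F' (extend ω) T
    simp only [extend_coe] at this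
    rw [this, ← Finset.sum_subset (Finset.range_subset_range.2 hτ)]
    · refine Finset.sum_congr rfl fun t ht => ?_
      simp [hF', Finset.mem_range.1 ht]
    · intro t _ ht
      simp only [Finset.mem_range] at ht
      simp [hF', ht]
  have hmk := mul_meas_ge_le_lintegral₀ (μ := law A η γ α env T)
    ((measurable_total hm T).exp.ennreal_ofReal.aemeasurable) (ENNReal.ofReal (Real.exp u))
  -- Passing to the superset on which Markov's inequality acts avoids any measurability of the event
  -- itself.
  have hsub : {ω : Fin T → Round | u <
      ∑ t ∈ Finset.range τ, F t (fun i => extend ω i) (extend ω t)} ⊆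
      {ω | ENNReal.ofReal (Real.exp u) ≤ ENNReal.ofReal (Real.exp (total F' T ω))} := by
    intro ω hω
    simp only [Set.mem_ofPred_eq] at hω ⊢
    rw [heq]
    exact ENNReal.ofReal_le_ofReal (Real.exp_le_exp.2 hω.le)
  have h2 : ENNReal.ofReal (Real.exp u) * law A η γ α env T
      {ω | u < ∑ t ∈ Finset.range τ, F t (fun i => extend ω i) (extend ω t)} ≤ 1 :=
    (mul_le_mul_right (measure_mono hsub) _).trans (hmk.trans hI)
  have h3 := ENNReal.toReal_mono ENNReal.one_ne_top h2
  rw [ENNReal.toReal_mul, ENNReal.toReal_ofReal (Real.exp_pos _).le, ENNReal.toReal_one] at h3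
  rw [Real.exp_neg, Measure.real]
  rwa [← one_div, le_div_iff₀' (Real.exp_pos _)]

/-! ### Exponential weights -/

/-- Potential argument: `log ∑ w` falls in each round by about `η` times the mean loss, up to a
quadratic error, and stays above `log (w a)`. Nonnegativity of the losses replaces the usual
smallness of `η * l`. It is asked only before `τ`, since later multipliers may be negative. -/
lemma sum_normalize_sub_le {A : Finset (I × I)} (hA : A.Nonempty) {η : ℝ} (hη : 0 < η)
    {l w : ℕ → I × I → ℝ} (τ : ℕ) (hl : ∀ t < τ, ∀ x ∈ A, 0 ≤ l t x) (h0 : ∀ x, w 0 x = 1)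
    (hw : ∀ t x, w (t + 1) x = w t x * Real.exp (-η * l t x)) {a : I × I} (ha : a ∈ A) :
    ∑ t ∈ Finset.range τ, ∑ x ∈ A, normalize A (w t) x * l t x -
        ∑ t ∈ Finset.range τ, l t a ≤
      Real.log A.card / η +
        η * ∑ t ∈ Finset.range τ, ∑ x ∈ A, normalize A (w t) x * l t x ^ 2 := by
  have hpos : ∀ t x, 0 < w t x := by
    intro t
    induction t with
    | zero => intro x; simp [h0]
    | succ t ih => intro x; rw [hw]; exact mul_pos (ih x) (Real.exp_pos _)
  have hW : ∀ t, 0 < ∑ x ∈ A, w t x := fun t => Finset.sum_pos (fun x _ => hpos t x) hA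
  have hup : ∀ n ≤ τ, Real.log (∑ x ∈ A, w n x) ≤ Real.log A.card +
      ∑ t ∈ Finset.range n, (-η * ∑ x ∈ A, normalize A (w t) x * l t x +
        η ^ 2 * ∑ x ∈ A, normalize A (w t) x * l t x ^ 2) := by
    intro n
    induction n with
    | zero => intro _; simp [h0]
    | succ n ih =>
      intro hn
      have hstep : ∑ x ∈ A, w (n + 1) x ≤ (∑ x ∈ A, w n x) *
          (1 + (-η * ∑ x ∈ A, normalize A (w n) x * l n x +
        η ^ 2 * ∑ x ∈ A, normalize A (w n) x * l n x ^ 2)) := by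
        have : (∑ x ∈ A, w n x) * (1 + (-η * ∑ x ∈ A, normalize A (w n) x * l n x +
            η ^ 2 * ∑ x ∈ A, normalize A (w n) x * l n x ^ 2)) =
            ∑ x ∈ A, w n x * (1 + -η * l n x + (-η * l n x) ^ 2) := by
          have e1 : ∀ f : I × I → ℝ, (∑ x ∈ A, w n x) * ∑ x ∈ A, normalize A (w n) x * f x =
              ∑ x ∈ A, w n x * f x := by
            intro f
            rw [Finset.mul_sum]
            refine Finset.sum_congr rfl fun x _ => ?_
            have := (hW n).ne'
            rw [normalize]
            field_simp
          calc _ = (∑ x ∈ A, w n x) + (-η * ((∑ x ∈ A, w n x) *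
                ∑ x ∈ A, normalize A (w n) x * l n x) + η ^ 2 * ((∑ x ∈ A, w n x) *
                ∑ x ∈ A, normalize A (w n) x * l n x ^ 2)) := by ring
            _ = _ := by
              rw [e1 (fun x => l n x), e1 (fun x => l n x ^ 2), Finset.mul_sum, Finset.mul_sum,
                ← Finset.sum_add_distrib, ← Finset.sum_add_distrib]
              exact Finset.sum_congr rfl fun x _ => by ring
        rw [this]
        refine Finset.sum_le_sum fun x hx => ?_
        rw [hw]
        refine mul_le_mul_of_nonneg_left (exp_le_one_add_add_sq ?_) (hpos n x).le
        have := mul_nonneg hη.le (hl n (by omega) x hx)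
        linarith
      have hlog := Real.log_le_log (hW (n + 1)) (hstep.trans (mul_le_mul_of_nonneg_left
        ((add_comm _ _).trans_le (Real.add_one_le_exp _)) (hW n).le))
      rw [Real.log_mul (hW n).ne' (Real.exp_pos _).ne', Real.log_exp] at hlog
      rw [Finset.sum_range_succ]
      linarith [ih (by omega)]
  have hlow : ∀ n, w n a = Real.exp (-η * ∑ t ∈ Finset.range n, l t a) := by
    intro n
    induction n with
    | zero => simp [h0]
    | succ n ih => rw [hw, ih, ← Real.exp_add, Finset.sum_range_succ]; ring_nf
  have h1 := hup τ le_rfl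
  have h2 : -η * ∑ t ∈ Finset.range τ, l t a ≤ Real.log (∑ x ∈ A, w τ x) := by
    rw [Real.le_log_iff_exp_le (hW τ), ← hlow]
    exact Finset.single_le_sum (f := fun x => w τ x) (fun x _ => (hpos τ x).le) ha
  rw [Finset.sum_add_distrib, ← Finset.mul_sum, ← Finset.mul_sum] at h1
  have h3 : η * (∑ t ∈ Finset.range τ, ∑ x ∈ A, normalize A (w t) x * l t x -
      ∑ t ∈ Finset.range τ, l t a) ≤ η * (Real.log A.card / η +
        η * ∑ t ∈ Finset.range τ, ∑ x ∈ A, normalize A (w t) x * l t x ^ 2) := by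
    have : η * (Real.log A.card / η) = Real.log A.card := by field_simp
    rw [mul_add, this]
    linarith
  exact le_of_mul_le_mul_left h3 hη

/-! ### The loss estimator -/

/-- The probability that the buyer price `x.2` is sampled with a uniform seller price. -/
def probB (A : Finset (I × I)) (α : ℝ) (ρ : I × I → ℝ) (x : I × I) : ℝ :=
  α / 2 * ∑ y ∈ A with y.2 = x.2, ρ y

/-- The probability that the seller price `x.1` is sampled with a uniform buyer price. -/
def probS (A : Finset (I × I)) (α : ℝ) (ρ : I × I → ℝ) (x : I × I) : ℝ :=
  α / 2 * ∑ y ∈ A with y.1 = x.1, ρ y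

/-- The part of the loss of `x` that comes from the seller. -/
def lossS (v x : I × I) : ℝ := 1 - if x.2 ≤ v.2 then max ((x.1 : ℝ) - v.1) 0 else 0

/-- The part of the loss of `x` that comes from the buyer. -/
def lossB (v x : I × I) : ℝ := 1 - if v.1 ≤ x.1 then max ((v.2 : ℝ) - x.2) 0 else 0

/-- The part of the loss of `x` that comes from the revenue. -/
def lossR (e : EnvMove) (x : I × I) : ℝ := (1 + e.2) * (1 - rev x e.1)

/-- The Lagrangian reward of the prices `x` against the move `e` of the environment. -/
def reward (e : EnvMove) (x : I × I) : ℝ := gft x e.1 + e.2 * rev x e.1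

/-- On a trade, `(p - s) + (b - q) + (1 + λ)(q - p) = (b - s) + λ (q - p)`. Without one, each of the
three rewards vanishes: when only one side accepts, the positive part of the other side's margin is
zero. -/
lemma lossS_add_lossB_add_lossR (e : EnvMove) (x : I × I) :
    lossS e.1 x + lossB e.1 x + lossR e x = 3 + e.2 - reward e x := by
  simp only [lossS, lossB, lossR, reward, gft, rev]
  by_cases h1 : x.2 ≤ e.1.2 <;> by_cases h2 : e.1.1 ≤ x.1
  · have h1' : (x.2 : ℝ) ≤ e.1.2 := h1
    have h2' : (e.1.1 : ℝ) ≤ x.1 := h2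
    simp only [h1, h2, and_self, if_true]
    rw [max_eq_left (by linarith), max_eq_left (by linarith)]
    ring
  · have h2' : (x.1 : ℝ) ≤ e.1.1 := (not_le.1 h2).le
    simp only [h1, h2, and_false, if_true, if_false]
    rw [max_eq_right (by linarith)]
    ring
  · have h1' : (e.1.2 : ℝ) ≤ x.2 := (not_le.1 h1).le
    simp only [h1, h2, false_and, if_true, if_false]
    rw [max_eq_right (by linarith)]
    ring
  · simp only [h1, h2, false_and, if_false]
    ring

lemma abs_rev_le (x v : I × I) : |rev x v| ≤ 1 := by
  unfold rev
  split_ifs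
  · exact abs_le.2 ⟨by linarith [x.2.2.1, x.1.2.2], by linarith [x.2.2.2, x.1.2.1]⟩
  · simp

lemma abs_gft_le (x v : I × I) : |gft x v| ≤ 1 := by
  unfold gft
  split_ifs
  · exact abs_le.2 ⟨by linarith [v.2.2.1, v.1.2.2], by linarith [v.2.2.2, v.1.2.1]⟩
  · simp

lemma abs_reward_le {M : ℝ} {e : EnvMove} (h0 : 0 ≤ e.2) (hM : e.2 ≤ M) (x : I × I) :
    |reward e x| ≤ 1 + M := by
  unfold reward
  refine (abs_add_le _ _).trans (add_le_add (abs_gft_le _ _) ?_)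
  rw [abs_mul, abs_of_nonneg h0]
  exact (mul_le_of_le_one_right h0 (abs_rev_le _ _)).trans hM

lemma lossS_nonneg (v x : I × I) : 0 ≤ lossS v x := by
  unfold lossS
  split_ifs
  · have : max ((x.1 : ℝ) - v.1) 0 ≤ 1 := max_le (by linarith [x.1.2.2, v.1.2.1]) zero_le_one
    linarith
  · norm_num

lemma lossS_le_one (v x : I × I) : lossS v x ≤ 1 := by
  unfold lossS
  split_ifs
  · linarith [le_max_right ((x.1 : ℝ) - v.1) 0]
  · norm_num

lemma lossB_nonneg (v x : I × I) : 0 ≤ lossB v x := by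
  unfold lossB
  split_ifs
  · have : max ((v.2 : ℝ) - x.2) 0 ≤ 1 := max_le (by linarith [v.2.2.2, x.2.2.1]) zero_le_one
    linarith
  · norm_num

lemma lossB_le_one (v x : I × I) : lossB v x ≤ 1 := by
  unfold lossB
  split_ifs
  · linarith [le_max_right ((v.2 : ℝ) - x.2) 0]
  · norm_num

lemma lossR_nonneg {e : EnvMove} (h0 : 0 ≤ e.2) (x : I × I) : 0 ≤ lossR e x :=
  mul_nonneg (by linarith) (by linarith [(abs_le.1 (abs_rev_le x e.1)).2])

lemma lossR_le {e : EnvMove} {M : ℝ} (h0 : 0 ≤ e.2) (hM : e.2 ≤ M) (x : I × I) :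
    lossR e x ≤ 2 * (1 + M) := by
  have h1 := (abs_le.1 (abs_rev_le x e.1)).1
  have h2 := (abs_le.1 (abs_rev_le x e.1)).2
  unfold lossR
  nlinarith

/-- Whether a uniform seller price `u` earns nothing for `x` in the seller part. -/
def missS (v x : I × I) (u : I) : ℝ :=
  1 - if v.1 ≤ u ∧ u ≤ x.1 ∧ x.2 ≤ v.2 then 1 else 0

/-- Whether a uniform buyer price `u` earns nothing for `x` in the buyer part. -/
def missB (v x : I × I) (u : I) : ℝ :=
  1 - if v.1 ≤ x.1 ∧ u ≤ v.2 ∧ x.2 ≤ u then 1 else 0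

lemma missS_eq (v x : I × I) (u : I) : missS v x u = 0 ∨ missS v x u = 1 := by
  unfold missS; split_ifs <;> simp

lemma missB_eq (v x : I × I) (u : I) : missB v x u = 0 ∨ missB v x u = 1 := by
  unfold missB; split_ifs <;> simp

lemma integral_one_sub_indicator_Icc (x y : I) :
    ∫ u : I, (1 - (Set.Icc x y).indicator (fun _ => (1 : ℝ)) u) = 1 - max ((y : ℝ) - x) 0 := by
  rw [integral_sub (integrable_const _) ((integrable_const _).indicator measurableSet_Icc),
    integral_indicator_const _ measurableSet_Icc]
  simp [Measure.real, unitInterval.volume_Icc, ENNReal.toReal_ofReal']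

/-- The chance that a uniform price lands in `[s, p]` is the margin `(p - s)⁺`; a single trade bit
therefore estimates the margin without bias. -/
lemma integral_missS (v x : I × I) : ∫ u, missS v x u = lossS v x := by
  unfold lossS
  split_ifs with h
  · rw [← integral_one_sub_indicator_Icc]
    refine integral_congr_ae (Filter.Eventually.of_forall fun u => ?_)
    simp [missS, h, Set.indicator_apply]
  · simp [missS, h]

lemma integral_missB (v x : I × I) : ∫ u, missB v x u = lossB v x := by
  unfold lossB
  split_ifs with h
  · rw [← integral_one_sub_indicator_Icc]
    refine integral_congr_ae (Filter.Eventually.of_forall fun u => ?_)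
    simp [missB, h, Set.indicator_apply, and_comm]
  · simp [missB, h]

/-! ### Values of the estimator under each exploration flag. -/

section lossEst

variable (A : Finset (I × I)) (α γ : ℝ) (ρ : I × I → ℝ) (e : EnvMove) (a : I × I) (y : I × I)
  (x : I × I)

lemma lossEst_zero : lossEst A α γ ρ (e, a, 0, y) x =
    if x = a then lossR e x / ((1 - α) * ρ x + γ) else 0 := by
  by_cases h : x = a
  · subst h; simp [lossEst, hat, flag, posted, lossR, val, mult]
  · simp [lossEst, hat, flag, h]

lemma lossEst_one : lossEst A α γ ρ (e, a, 1, y) x =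
    if x.2 = a.2 then missS e.1 x y.1 / (probB A α ρ x + γ) else 0 := by
  by_cases h : x.2 = a.2
  · simp [lossEst, hat, flag, h, missS, val, unifS, probB]
  · simp [lossEst, hat, flag, h]

lemma lossEst_two : lossEst A α γ ρ (e, a, 2, y) x =
    if x.1 = a.1 then missB e.1 x y.2 / (probS A α ρ x + γ) else 0 := by
  by_cases h : x.1 = a.1
  · simp [lossEst, hat, flag, h, missB, val, unifB, probS]
  · simp [lossEst, hat, flag, h]

end lossEst

/-! ### Exact moments of the estimator for a fixed pair. -/

section moments

variable {A : Finset (I × I)} {α γ M : ℝ} {ρ : I × I → ℝ} {e : EnvMove} {x : I × I}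

/-- The estimator and its square both have this shape, with different constants, so one computation
gives both moments. -/
lemma drawMean_eq {G : Draw → ℝ} (hx : x ∈ A) {c₀ c₁ c₂ : ℝ} (v : I × I)
    (h₀ : ∀ a y, G (a, 0, y) = if x = a then c₀ else 0)
    (h₁ : ∀ a y, G (a, 1, y) = if x.2 = a.2 then c₁ * missS v x y.1 else 0)
    (h₂ : ∀ a y, G (a, 2, y) = if x.1 = a.1 then c₂ * missB v x y.2 else 0) :
    drawMean A α ρ G = probB A α ρ x * (c₁ * lossS v x) + probS A α ρ x * (c₂ * lossB v x) +
      (1 - α) * ρ x * c₀ := by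
  have i0 : ∀ a, ∫ y, G (a, 0, y) = if x = a then c₀ else 0 := fun a => by simp [h₀]
  have i1 : ∀ a, ∫ y, G (a, 1, y) = if x.2 = a.2 then c₁ * lossS v x else 0 := fun a => by
    simp only [h₁]
    split_ifs
    · rw [← integral_missS, ← integral_const_mul]
      have := integral_fun_fst (μ := (volume : Measure I)) (ν := (volume : Measure I))
        (fun u => c₁ * missS v x u)
      rwa [probReal_univ, one_smul] at this
    · simp
  have i2 : ∀ a, ∫ y, G (a, 2, y) = if x.1 = a.1 then c₂ * lossB v x else 0 := fun a => by
    simp only [h₂]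
    split_ifs
    · rw [← integral_missB, ← integral_const_mul]
      have := integral_fun_snd (μ := (volume : Measure I)) (ν := (volume : Measure I))
        (fun u => c₂ * missB v x u)
      rwa [probReal_univ, one_smul] at this
    · simp
  have e0 : ∑ a ∈ A, ρ a * ((1 - α) * if x = a then c₀ else 0) = (1 - α) * ρ x * c₀ := by
    simp only [mul_ite, mul_zero, Finset.sum_ite_eq, hx, if_true]
    ring
  have e1 : ∑ a ∈ A, ρ a * (α / 2 * if x.2 = a.2 then c₁ * lossS v x else 0) =
      probB A α ρ x * (c₁ * lossS v x) := by
    simp only [probB, Finset.sum_filter, mul_ite, mul_zero, Finset.mul_sum, Finset.sum_mul,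
      ite_mul, zero_mul, eq_comm (a := x.2)]
    exact Finset.sum_congr rfl fun a _ => by split_ifs <;> ring
  have e2 : ∑ a ∈ A, ρ a * (α / 2 * if x.1 = a.1 then c₂ * lossB v x else 0) =
      probS A α ρ x * (c₂ * lossB v x) := by
    simp only [probS, Finset.sum_filter, mul_ite, mul_zero, Finset.mul_sum, Finset.sum_mul,
      ite_mul, zero_mul, eq_comm (a := x.1)]
    exact Finset.sum_congr rfl fun a _ => by split_ifs <;> ring
  simp only [drawMean, i0, i1, i2]
  rw [← e0, ← e1, ← e2, ← Finset.sum_add_distrib, ← Finset.sum_add_distrib]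
  exact Finset.sum_congr rfl fun a _ => by ring

lemma drawMean_lossEst (hx : x ∈ A) :
    drawMean A α ρ (fun d => lossEst A α γ ρ (e, d) x) =
      probB A α ρ x * (1 / (probB A α ρ x + γ) * lossS e.1 x) +
      probS A α ρ x * (1 / (probS A α ρ x + γ) * lossB e.1 x) +
      (1 - α) * ρ x * (lossR e x / ((1 - α) * ρ x + γ)) := by
  refine drawMean_eq hx e.1 (fun a y => lossEst_zero ..) (fun a y => ?_) (fun a y => ?_)
  · rw [lossEst_one, div_eq_inv_mul, one_div]
  · rw [lossEst_two, div_eq_inv_mul, one_div]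

/-- The miss variables take values `0` and `1`, hence equal their squares; this is why `lossS` and
`lossB` occur only to the first power. -/
lemma drawMean_lossEst_sq (hx : x ∈ A) :
    drawMean A α ρ (fun d => lossEst A α γ ρ (e, d) x ^ 2) =
      probB A α ρ x * (1 / (probB A α ρ x + γ) ^ 2 * lossS e.1 x) +
      probS A α ρ x * (1 / (probS A α ρ x + γ) ^ 2 * lossB e.1 x) +
      (1 - α) * ρ x * (lossR e x / ((1 - α) * ρ x + γ)) ^ 2 := by
  refine drawMean_eq hx e.1 (fun a y => ?_) (fun a y => ?_) (fun a y => ?_)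
  · rw [lossEst_zero]; split_ifs <;> simp
  · rw [lossEst_one]
    split_ifs
    · rcases missS_eq e.1 x y.1 with h | h <;> simp [h]
    · simp
  · rw [lossEst_two]
    split_ifs
    · rcases missB_eq e.1 x y.2 with h | h <;> simp [h]
    · simp

lemma probB_nonneg (h0 : 0 ≤ α) (hρ : ∀ a ∈ A, 0 ≤ ρ a) : 0 ≤ probB A α ρ x :=
  mul_nonneg (by linarith) (Finset.sum_nonneg fun y hy => hρ y (Finset.mem_filter.1 hy).1)

lemma probS_nonneg (h0 : 0 ≤ α) (hρ : ∀ a ∈ A, 0 ≤ ρ a) : 0 ≤ probS A α ρ x :=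
  mul_nonneg (by linarith) (Finset.sum_nonneg fun y hy => hρ y (Finset.mem_filter.1 hy).1)

lemma missS_nonneg (v x : I × I) (u : I) : 0 ≤ missS v x u := by
  rcases missS_eq v x u with h | h <;> simp [h]

lemma missS_le_one (v x : I × I) (u : I) : missS v x u ≤ 1 := by
  rcases missS_eq v x u with h | h <;> simp [h]

lemma missB_nonneg (v x : I × I) (u : I) : 0 ≤ missB v x u := by
  rcases missB_eq v x u with h | h <;> simp [h]

lemma missB_le_one (v x : I × I) (u : I) : missB v x u ≤ 1 := by
  rcases missB_eq v x u with h | h <;> simp [h]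

lemma draw_cases {P : Draw → Prop} (h0 : ∀ a y, P (a, 0, y)) (h1 : ∀ a y, P (a, 1, y))
    (h2 : ∀ a y, P (a, 2, y)) (d : Draw) : P d := by
  obtain ⟨a, i, y⟩ := d
  fin_cases i
  · exact h0 a y
  · exact h1 a y
  · exact h2 a y

lemma lossEst_nonneg (h0 : 0 ≤ α) (h1 : α ≤ 1) (hγ : 0 < γ) (hρ : ∀ a ∈ A, 0 ≤ ρ a)
    (he : 0 ≤ e.2) (hx : x ∈ A) (d : Draw) : 0 ≤ lossEst A α γ ρ (e, d) x := by
  have h3 : 0 ≤ (1 - α) * ρ x := mul_nonneg (by linarith) (hρ x hx)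
  have h4 := probB_nonneg (x := x) h0 hρ
  have h5 := probS_nonneg (x := x) h0 hρ
  induction d using draw_cases with
  | h0 a y =>
    rw [lossEst_zero]; split_ifs
    · exact div_nonneg (lossR_nonneg he x) (by linarith)
    · exact le_rfl
  | h1 a y =>
    rw [lossEst_one]; split_ifs
    · exact div_nonneg (missS_nonneg _ _ _) (by linarith)
    · exact le_rfl
  | h2 a y =>
    rw [lossEst_two]; split_ifs
    · exact div_nonneg (missB_nonneg _ _ _) (by linarith)
    · exact le_rfl

lemma lossEst_le (h0 : 0 ≤ α) (h1 : α ≤ 1) (hγ : 0 < γ) (hρ : ∀ a ∈ A, 0 ≤ ρ a)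
    (he : 0 ≤ e.2) (heM : e.2 ≤ M) (hx : x ∈ A) (d : Draw) :
    lossEst A α γ ρ (e, d) x ≤ 2 * (1 + M) / γ := by
  have h3 : 0 ≤ (1 - α) * ρ x := mul_nonneg (by linarith) (hρ x hx)
  have h4 := probB_nonneg (x := x) h0 hρ
  have h5 := probS_nonneg (x := x) h0 hρ
  have hB : 0 ≤ 2 * (1 + M) / γ := div_nonneg (by linarith) hγ.le
  have key : ∀ z D : ℝ, z ≤ 2 * (1 + M) → 0 ≤ D → z / (D + γ) ≤ 2 * (1 + M) / γ :=
    fun z D hz hD => div_le_div₀ (by linarith) hz hγ (by linarith)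
  induction d using draw_cases with
  | h0 a y =>
    rw [lossEst_zero]; split_ifs
    · exact key _ _ (lossR_le he heM x) h3
    · exact hB
  | h1 a y =>
    rw [lossEst_one]; split_ifs
    · exact key _ _ ((missS_le_one _ _ _).trans (by linarith)) h4
    · exact hB
  | h2 a y =>
    rw [lossEst_two]; split_ifs
    · exact key _ _ ((missB_le_one _ _ _).trans (by linarith)) h5
    · exact hB

lemma bddMeas_lossEst (h0 : 0 ≤ α) (h1 : α ≤ 1) (hγ : 0 < γ) (hρ : ∀ a ∈ A, 0 ≤ ρ a)
    (he : 0 ≤ e.2) (hx : x ∈ A) : BddMeas fun d => lossEst A α γ ρ (e, d) x := by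
  refine ⟨measurable_lossEst A α γ x (ρ := fun _ => ρ) (fun b => measurable_const)
    measurable_prodMk_left, 2 * (1 + e.2) / γ, fun d => ?_⟩
  rw [abs_of_nonneg (lossEst_nonneg h0 h1 hγ hρ he hx d)]
  exact lossEst_le h0 h1 hγ hρ he le_rfl hx d

end moments

/-! ### Moments of the estimators -/

section moments

variable {A : Finset (I × I)} {α γ M : ℝ} {ρ : I × I → ℝ} {e : EnvMove} {x : I × I}

/-- Reduces to `p (p + γ) + κ p ≤ (p + γ)²`: the downward bias caused by `γ` pays for `κ` times the
second moment. -/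
lemma implicit_exploration_le {p l κ : ℝ} (hγ : 0 < γ) (hp : 0 ≤ p) (hl : 0 ≤ l) (hκ : κ ≤ γ) :
    p * (l / (p + γ)) + κ * (p * (l / (p + γ) ^ 2)) ≤ l := by
  have h : 0 < p + γ := by linarith
  have e1 : p * (l / (p + γ)) + κ * (p * (l / (p + γ) ^ 2)) =
      l * ((p * (p + γ) + κ * p) / (p + γ) ^ 2) := by field_simp
  rw [e1]
  refine mul_le_of_le_one_right hl ((div_le_one (by positivity)).2 ?_)
  nlinarith [mul_le_mul_of_nonneg_right hκ hp, sq_nonneg γ]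

/-- The factor `γ / (2 * (1 + M))` serves all three parts: it is at most `γ`, and multiplied by
`lossR ≤ 2 * (1 + M)` it still is. The small-loss bound for `overProcess` thus carries no variance
term. -/
lemma drawMean_lossEst_add_sq_le (h0 : 0 ≤ α) (h1 : α ≤ 1) (hγ : 0 < γ)
    (hρ : ∀ a ∈ A, 0 ≤ ρ a) (he : 0 ≤ e.2) (heM : e.2 ≤ M) (hx : x ∈ A) :
    drawMean A α ρ (fun d => lossEst A α γ ρ (e, d) x) +
      γ / (2 * (1 + M)) * drawMean A α ρ (fun d => lossEst A α γ ρ (e, d) x ^ 2) ≤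
      3 + e.2 - reward e x := by
  have h3 : 0 ≤ (1 - α) * ρ x := mul_nonneg (by linarith) (hρ x hx)
  have h4 := probB_nonneg (x := x) h0 hρ
  have h5 := probS_nonneg (x := x) h0 hρ
  have hB : 0 < 2 * (1 + M) := by linarith
  have hc : γ / (2 * (1 + M)) ≤ γ := div_le_self hγ.le (by linarith)
  have hcl : γ / (2 * (1 + M)) * lossR e x ≤ γ := by
    rw [div_mul_eq_mul_div, div_le_iff₀ hB]
    exact mul_le_mul_of_nonneg_left (lossR_le he heM x) hγ.le
  have k1 := implicit_exploration_le hγ h4 (lossS_nonneg e.1 x) hc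
  have k2 := implicit_exploration_le hγ h5 (lossB_nonneg e.1 x) hc
  have k3 := implicit_exploration_le hγ h3 (lossR_nonneg he x) hcl
  rw [← lossS_add_lossB_add_lossR, drawMean_lossEst hx, drawMean_lossEst_sq hx, div_pow]
  refine le_trans (le_of_eq ?_) (add_le_add (add_le_add k1 k2) k3)
  ring

lemma sub_le_implicit_exploration {p l b : ℝ} (hγ : 0 < γ) (hp : 0 < p) (hb : 0 ≤ b)
    (hl : l ≤ b) : l - γ * (b / p) ≤ p * (l / (p + γ)) := by
  have h : 0 < p + γ := by linarith
  have e1 : p * (l / (p + γ)) = l - γ * (l / (p + γ)) := by field_simp; ring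
  rw [e1]
  have : l / (p + γ) ≤ b / p := div_le_div₀ hb hl hp (by linarith)
  linarith [mul_le_mul_of_nonneg_left this hγ.le]

lemma implicit_exploration_sq_le {p l b : ℝ} (hγ : 0 < γ) (hp : 0 < p) (hb : 0 ≤ b)
    (hl : l ≤ b) : p * (l / (p + γ) ^ 2) ≤ b / p := by
  have h : 0 < p + γ := by linarith
  have : l / (p + γ) ^ 2 ≤ b / p ^ 2 :=
    div_le_div₀ hb hl (by positivity) (pow_le_pow_left₀ hp.le (by linarith) 2)
  calc p * (l / (p + γ) ^ 2) ≤ p * (b / p ^ 2) := mul_le_mul_of_nonneg_left this hp.le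
    _ = b / p := by field_simp

lemma probB_pos (h0 : 0 < α) (hρ : ∀ a, 0 < ρ a) (hx : x ∈ A) : 0 < probB A α ρ x :=
  mul_pos (by linarith) (Finset.sum_pos (fun y _ => hρ y)
    ⟨x, Finset.mem_filter.2 ⟨hx, rfl⟩⟩)

lemma probS_pos (h0 : 0 < α) (hρ : ∀ a, 0 < ρ a) (hx : x ∈ A) : 0 < probS A α ρ x :=
  mul_pos (by linarith) (Finset.sum_pos (fun y _ => hρ y)
    ⟨x, Finset.mem_filter.2 ⟨hx, rfl⟩⟩)

/-- `probB` is constant on the pairs sharing a buyer price, where it is `α / 2` times their total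
mass. Each such fibre contributes exactly `2 / α`, so buyer prices are counted instead of pairs. -/
lemma sum_div_probB (h0 : 0 < α) (hρ : ∀ a, 0 < ρ a) :
    ∑ x ∈ A, ρ x * (1 / probB A α ρ x) = 2 / α * (buyerPrices A).card := by
  rw [← Finset.sum_fiberwise_of_maps_to (t := buyerPrices A) (g := Prod.snd)
    fun x hx => Finset.mem_image_of_mem _ hx]
  have : ∀ q ∈ buyerPrices A, ∑ x ∈ A with x.2 = q, ρ x * (1 / probB A α ρ x) = 2 / α := by
    intro q hq
    obtain ⟨z, hz, rfl⟩ := Finset.mem_image.1 hq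
    have hz' := probB_pos h0 hρ hz
    have e1 : ∀ x ∈ A.filter (fun x => x.2 = z.2), ρ x * (1 / probB A α ρ x) =
        ρ x * (1 / probB A α ρ z) := fun x hx => by
      rw [probB, probB, (Finset.mem_filter.1 hx).2]
    rw [Finset.sum_congr rfl e1, ← Finset.sum_mul]
    unfold probB at hz' ⊢
    have : 0 < ∑ y ∈ A with y.2 = z.2, ρ y := pos_of_mul_pos_right hz' (by linarith)
    field_simp
  rw [Finset.sum_congr rfl this, Finset.sum_const, nsmul_eq_mul, mul_comm]

lemma sum_div_probS (h0 : 0 < α) (hρ : ∀ a, 0 < ρ a) :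
    ∑ x ∈ A, ρ x * (1 / probS A α ρ x) = 2 / α * (sellerPrices A).card := by
  rw [← Finset.sum_fiberwise_of_maps_to (t := sellerPrices A) (g := Prod.fst)
    fun x hx => Finset.mem_image_of_mem _ hx]
  have : ∀ q ∈ sellerPrices A, ∑ x ∈ A with x.1 = q, ρ x * (1 / probS A α ρ x) = 2 / α := by
    intro q hq
    obtain ⟨z, hz, rfl⟩ := Finset.mem_image.1 hq
    have hz' := probS_pos h0 hρ hz
    have e1 : ∀ x ∈ A.filter (fun x => x.1 = z.1), ρ x * (1 / probS A α ρ x) =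
        ρ x * (1 / probS A α ρ z) := fun x hx => by
      rw [probS, probS, (Finset.mem_filter.1 hx).2]
    rw [Finset.sum_congr rfl e1, ← Finset.sum_mul]
    unfold probS at hz' ⊢
    have : 0 < ∑ y ∈ A with y.1 = z.1, ρ y := pos_of_mul_pos_right hz' (by linarith)
    field_simp
  rw [Finset.sum_congr rfl this, Finset.sum_const, nsmul_eq_mul, mul_comm]

/-- The sum over `A` of the sampling probability divided by the observation probabilities. -/
lemma sum_div_prob_le (h0 : 0 < α) (h1 : α ≤ 1 / 2) (hρ : ∀ a, 0 < ρ a) {b : ℝ} (hb : 0 ≤ b) :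
    ∑ x ∈ A, ρ x * (1 / probB A α ρ x + 1 / probS A α ρ x + b / ((1 - α) * ρ x)) ≤
      2 * ((sellerPrices A).card + (buyerPrices A).card) / α + 2 * b * A.card := by
  have e1 : ∑ x ∈ A, ρ x * (b / ((1 - α) * ρ x)) = A.card * (b / (1 - α)) := by
    rw [← nsmul_eq_mul, ← Finset.sum_const]
    refine Finset.sum_congr rfl fun x _ => ?_
    have := (hρ x).ne'
    have : 1 - α ≠ 0 := by linarith
    field_simp
  have e2 : b / (1 - α) ≤ 2 * b := by
    rw [div_le_iff₀ (by linarith)]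
    nlinarith
  simp only [mul_add, Finset.sum_add_distrib]
  rw [sum_div_probB h0 hρ, sum_div_probS h0 hρ, e1]
  have := mul_le_mul_of_nonneg_left e2 (Nat.cast_nonneg (α := ℝ) A.card)
  refine (add_le_add_right this _).trans (le_of_eq ?_)
  ring

/-- Exploration rounds, of total weight `α`, receive a uniform bound; the others may keep their
dependence on the sampled pair. -/
lemma drawMean_le_sum (h0 : 0 ≤ α) (h1 : α ≤ 1) (hρ : ∀ a ∈ A, 0 ≤ ρ a) {G : Draw → ℝ}
    (hG : BddMeas G) {b₀ : I × I → ℝ} {b₁ : ℝ} (hb₀ : ∀ a ∈ A, ∀ y, G (a, 0, y) ≤ b₀ a)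
    (hb₁ : ∀ a ∈ A, ∀ y, G (a, 1, y) ≤ b₁) (hb₂ : ∀ a ∈ A, ∀ y, G (a, 2, y) ≤ b₁) :
    drawMean A α ρ G ≤ ∑ a ∈ A, ρ a * ((1 - α) * b₀ a + α * b₁) := by
  have key : ∀ a ∈ A, ∀ i b, (∀ y, G (a, i, y) ≤ b) → ∫ y, G (a, i, y) ≤ b := by
    intro a _ i b hb
    refine (integral_mono (hG.integrable a i) (integrable_const b) hb).trans ?_
    simp
  refine Finset.sum_le_sum fun a ha => mul_le_mul_of_nonneg_left ?_ (hρ a ha)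
  have k0 := mul_le_mul_of_nonneg_left (key a ha 0 _ (hb₀ a ha)) (show 0 ≤ 1 - α by linarith)
  have k1 := mul_le_mul_of_nonneg_left (key a ha 1 b₁ (hb₁ a ha)) (show 0 ≤ α / 2 by linarith)
  have k2 := mul_le_mul_of_nonneg_left (key a ha 2 b₁ (hb₂ a ha)) (show 0 ≤ α / 2 by linarith)
  linarith

/-- The average under `ρ` of the estimated losses. -/
def estMean (A : Finset (I × I)) (α γ : ℝ) (ρ : I × I → ℝ) (r : Round) : ℝ :=
  ∑ x ∈ A, ρ x * lossEst A α γ ρ r x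

/-- The average under `ρ` of the squared estimated losses. -/
def estSq (A : Finset (I × I)) (α γ : ℝ) (ρ : I × I → ℝ) (r : Round) : ℝ :=
  ∑ x ∈ A, ρ x * lossEst A α γ ρ r x ^ 2

lemma sum_mul_le_probB {f : I × I → ℝ} {k : ℝ} {a : I × I} (h0 : 0 < α) (hρ : ∀ a, 0 < ρ a)
    (hf : ∀ x ∈ A, f x ≤ if x.2 = a.2 then k else 0) :
    ∑ x ∈ A, ρ x * f x ≤ 2 / α * (k * probB A α ρ a) := by
  calc ∑ x ∈ A, ρ x * f x ≤ ∑ x ∈ A, ρ x * (if x.2 = a.2 then k else 0) :=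
        Finset.sum_le_sum fun x hx => mul_le_mul_of_nonneg_left (hf x hx) (hρ x).le
    _ = _ := by
      simp only [mul_ite, mul_zero, ← Finset.sum_filter, ← Finset.sum_mul, probB]
      field_simp

lemma sum_mul_le_probS {f : I × I → ℝ} {k : ℝ} {a : I × I} (h0 : 0 < α) (hρ : ∀ a, 0 < ρ a)
    (hf : ∀ x ∈ A, f x ≤ if x.1 = a.1 then k else 0) :
    ∑ x ∈ A, ρ x * f x ≤ 2 / α * (k * probS A α ρ a) := by
  calc ∑ x ∈ A, ρ x * f x ≤ ∑ x ∈ A, ρ x * (if x.1 = a.1 then k else 0) :=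
        Finset.sum_le_sum fun x hx => mul_le_mul_of_nonneg_left (hf x hx) (hρ x).le
    _ = _ := by
      simp only [mul_ite, mul_zero, ← Finset.sum_filter, ← Finset.sum_mul, probS]
      field_simp

lemma probB_congr {a : I × I} (h : x.2 = a.2) : probB A α ρ x = probB A α ρ a := by
  rw [probB, probB, h]

lemma probS_congr {a : I × I} (h : x.1 = a.1) : probS A α ρ x = probS A α ρ a := by
  rw [probS, probS, h]

section

variable (h0 : 0 < α) (h1 : α ≤ 1 / 2) (hγ : 0 < γ) (hρ : ∀ a, 0 < ρ a)
include h0 hγ hρ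

lemma estMean_nonneg (h1 : α ≤ 1) (he : 0 ≤ e.2) (d : Draw) : 0 ≤ estMean A α γ ρ (e, d) :=
  Finset.sum_nonneg fun x hx => mul_nonneg (hρ x).le
    (lossEst_nonneg h0.le h1 hγ (fun a _ => (hρ a).le) he hx d)

/-- Only the fibre of the sampled buyer price is charged. Its mass is `2 / α * probB`, which cancels
the denominator. -/
lemma estMean_one_le (a y : I × I) : estMean A α γ ρ (e, a, 1, y) ≤ 2 / α := by
  have hp : 0 ≤ probB A α ρ a := probB_nonneg h0.le fun a _ => (hρ a).le
  refine (sum_mul_le_probB (k := 1 / (probB A α ρ a + γ)) (a := a) h0 hρ fun x _ => ?_).trans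
    (mul_le_of_le_one_right (by positivity) ?_)
  · rw [lossEst_one]
    split_ifs with h
    · rw [probB_congr h]
      exact div_le_div_of_nonneg_right (missS_le_one _ _ _) (by linarith)
    · exact le_rfl
  · rw [div_mul_eq_mul_div, one_mul, div_le_one (by linarith)]
    linarith

lemma estMean_two_le (a y : I × I) : estMean A α γ ρ (e, a, 2, y) ≤ 2 / α := by
  have hp : 0 ≤ probS A α ρ a := probS_nonneg h0.le fun a _ => (hρ a).le
  refine (sum_mul_le_probS (k := 1 / (probS A α ρ a + γ)) (a := a) h0 hρ fun x _ => ?_).trans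
    (mul_le_of_le_one_right (by positivity) ?_)
  · rw [lossEst_two]
    split_ifs with h
    · rw [probS_congr h]
      exact div_le_div_of_nonneg_right (missB_le_one _ _ _) (by linarith)
    · exact le_rfl
  · rw [div_mul_eq_mul_div, one_mul, div_le_one (by linarith)]
    linarith

lemma estSq_one_le (a y : I × I) : estSq A α γ ρ (e, a, 1, y) ≤ 2 / α / γ := by
  have hp : 0 ≤ probB A α ρ a := probB_nonneg h0.le fun a _ => (hρ a).le
  have hq : 0 < probB A α ρ a + γ := by linarith
  refine (sum_mul_le_probB (k := 1 / (probB A α ρ a + γ) ^ 2) (a := a) h0 hρ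
    fun x _ => ?_).trans ?_
  · rw [lossEst_one]
    split_ifs with h
    · rw [probB_congr h, div_pow]
      exact div_le_div_of_nonneg_right (pow_le_one₀ (missS_nonneg _ _ _) (missS_le_one _ _ _))
        (by positivity)
    · simp
  · rw [div_eq_mul_inv (2 / α) γ, ← one_div]
    refine mul_le_mul_of_nonneg_left ?_ (by positivity)
    rw [div_mul_eq_mul_div, one_mul, div_le_div_iff₀ (by positivity) hγ]
    nlinarith

lemma estSq_two_le (a y : I × I) : estSq A α γ ρ (e, a, 2, y) ≤ 2 / α / γ := by
  have hp : 0 ≤ probS A α ρ a := probS_nonneg h0.le fun a _ => (hρ a).le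
  have hq : 0 < probS A α ρ a + γ := by linarith
  refine (sum_mul_le_probS (k := 1 / (probS A α ρ a + γ) ^ 2) (a := a) h0 hρ
    fun x _ => ?_).trans ?_
  · rw [lossEst_two]
    split_ifs with h
    · rw [probS_congr h, div_pow]
      exact div_le_div_of_nonneg_right (pow_le_one₀ (missB_nonneg _ _ _) (missB_le_one _ _ _))
        (by positivity)
    · simp
  · rw [div_eq_mul_inv (2 / α) γ, ← one_div]
    refine mul_le_mul_of_nonneg_left ?_ (by positivity)
    rw [div_mul_eq_mul_div, one_mul, div_le_div_iff₀ (by positivity) hγ]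
    nlinarith

include h1

omit h0 in
lemma estMean_zero_le (he : 0 ≤ e.2) (heM : e.2 ≤ M) {a : I × I} (ha : a ∈ A) (y : I × I) :
    estMean A α γ ρ (e, a, 0, y) ≤ 2 * (2 * (1 + M)) := by
  have := hρ a
  have hp : ρ a / 2 ≤ (1 - α) * ρ a := by nlinarith
  simp only [estMean, lossEst_zero, mul_ite, mul_zero, Finset.sum_ite_eq', ha, if_true]
  rw [mul_div_assoc', div_le_iff₀ (by linarith)]
  have h3 := mul_le_mul_of_nonneg_left (lossR_le he heM a) (hρ a).le
  have h4 : (2 * (2 * (1 + M))) * (ρ a / 2) ≤ (2 * (2 * (1 + M))) * ((1 - α) * ρ a + γ) :=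
    mul_le_mul_of_nonneg_left (by linarith) (by linarith)
  linarith

omit h0 in
lemma estSq_zero_le (he : 0 ≤ e.2) (heM : e.2 ≤ M) {a : I × I} (ha : a ∈ A) (y : I × I) :
    estSq A α γ ρ (e, a, 0, y) ≤ 2 * (2 * (1 + M)) ^ 2 / γ := by
  have := hρ a
  have hp : ρ a / 2 ≤ (1 - α) * ρ a := by nlinarith
  have hl := lossR_nonneg he a
  have hM : 0 ≤ M := he.trans heM
  simp only [estSq, lossEst_zero, ite_pow, mul_ite, ne_eq, OfNat.ofNat_ne_zero,
    not_false_eq_true, zero_pow, mul_zero, Finset.sum_ite_eq', ha, if_true]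
  have h2 : lossR e a ^ 2 ≤ (2 * (1 + M)) ^ 2 := pow_le_pow_left₀ hl (lossR_le he heM a) 2
  have h3 : ρ a / 2 * γ ≤ ((1 - α) * ρ a + γ) ^ 2 := by nlinarith
  have hD : 0 < (1 - α) * ρ a + γ := by linarith
  rw [div_pow, mul_div_assoc', div_le_div_iff₀ (by positivity) hγ]
  calc ρ a * lossR e a ^ 2 * γ ≤ ρ a * (2 * (1 + M)) ^ 2 * γ := by gcongr
    _ = 2 * (2 * (1 + M)) ^ 2 * (ρ a / 2 * γ) := by ring
    _ ≤ _ := mul_le_mul_of_nonneg_left h3 (by positivity)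

lemma bddMeas_estMean (he : 0 ≤ e.2) : BddMeas fun d => estMean A α γ ρ (e, d) :=
  BddMeas.sum A fun x hx => (bddMeas_lossEst h0.le (by linarith) hγ
    (fun a _ => (hρ a).le) he hx).const_mul (ρ x)

lemma bddMeas_estSq (he : 0 ≤ e.2) : BddMeas fun d => estSq A α γ ρ (e, d) :=
  BddMeas.sum A fun x hx => ((bddMeas_lossEst h0.le (by linarith) hγ
    (fun a _ => (hρ a).le) he hx).sq).const_mul (ρ x)

lemma drawMean_estMean_ge (he : 0 ≤ e.2) (heM : e.2 ≤ M) :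
    ∑ x ∈ A, ρ x * (3 + e.2 - reward e x) -
      γ * (2 * ((sellerPrices A).card + (buyerPrices A).card) / α +
        2 * (2 * (1 + M)) * A.card) ≤
    drawMean A α ρ fun d => estMean A α γ ρ (e, d) := by
  have hB : 0 ≤ 2 * (1 + M) := by linarith
  have hs := mul_le_mul_of_nonneg_left (sum_div_prob_le (A := A) h0 h1 hρ hB) hγ.le
  have hm : drawMean A α ρ (fun d => estMean A α γ ρ (e, d)) =
      ∑ x ∈ A, ρ x * drawMean A α ρ (fun d => lossEst A α γ ρ (e, d) x) := by
    simp only [estMean]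
    rw [drawMean_sum A fun x hx => (bddMeas_lossEst h0.le (by linarith) hγ
      (fun a _ => (hρ a).le) he hx).const_mul (ρ x)]
    simp only [drawMean_const_mul]
  rw [hm]
  refine (sub_le_sub_left hs _).trans ?_
  rw [Finset.mul_sum, ← Finset.sum_sub_distrib]
  refine Finset.sum_le_sum fun x hx => ?_
  have k1 := sub_le_implicit_exploration hγ (probB_pos h0 hρ hx) zero_le_one
    (lossS_le_one e.1 x)
  have k2 := sub_le_implicit_exploration hγ (probS_pos h0 hρ hx) zero_le_one
    (lossB_le_one e.1 x)
  have k3 := sub_le_implicit_exploration hγ (mul_pos (by linarith : 0 < 1 - α) (hρ x)) hB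
    (lossR_le he heM x)
  rw [drawMean_lossEst hx, ← lossS_add_lossB_add_lossR]
  rw [div_eq_inv_mul, ← one_div] at k1 k2
  have k := mul_le_mul_of_nonneg_left (add_le_add (add_le_add k1 k2) k3) (hρ x).le
  refine le_trans (le_of_eq ?_) (k.trans (le_of_eq ?_)) <;> ring

lemma drawMean_estSq_le (he : 0 ≤ e.2) (heM : e.2 ≤ M) :
    drawMean A α ρ (fun d => estSq A α γ ρ (e, d)) ≤
      2 * ((sellerPrices A).card + (buyerPrices A).card) / α +
        2 * (2 * (1 + M)) ^ 2 * A.card := by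
  have hB : 0 ≤ 2 * (1 + M) := by linarith
  refine le_trans ?_ (sum_div_prob_le (A := A) h0 h1 hρ (b := (2 * (1 + M)) ^ 2) (by positivity))
  have hm : drawMean A α ρ (fun d => estSq A α γ ρ (e, d)) =
      ∑ x ∈ A, ρ x * drawMean A α ρ (fun d => lossEst A α γ ρ (e, d) x ^ 2) := by
    simp only [estSq]
    rw [drawMean_sum A fun x hx => ((bddMeas_lossEst h0.le (by linarith) hγ
      (fun a _ => (hρ a).le) he hx).sq).const_mul (ρ x)]
    simp only [drawMean_const_mul]
  rw [hm]
  refine Finset.sum_le_sum fun x hx => mul_le_mul_of_nonneg_left ?_ (hρ x).le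
  have k1 := implicit_exploration_sq_le hγ (probB_pos h0 hρ hx) zero_le_one
    (lossS_le_one e.1 x)
  have k2 := implicit_exploration_sq_le hγ (probS_pos h0 hρ hx) zero_le_one
    (lossB_le_one e.1 x)
  have k3 := implicit_exploration_sq_le hγ (mul_pos (by linarith : 0 < 1 - α) (hρ x))
    (by positivity) (pow_le_pow_left₀ (lossR_nonneg he x) (lossR_le he heM x) 2)
  rw [drawMean_lossEst_sq hx, div_pow]
  refine le_trans (le_of_eq ?_) (add_le_add (add_le_add k1 k2) k3)
  ring

lemma drawMean_estMean_sq_le (hs : ∑ a ∈ A, ρ a = 1) (he : 0 ≤ e.2) (heM : e.2 ≤ M) :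
    drawMean A α ρ (fun d => estMean A α γ ρ (e, d) ^ 2) ≤
      4 * (2 * (1 + M)) ^ 2 + 4 / α := by
  have hn := fun d => estMean_nonneg (A := A) h0 hγ hρ (by linarith) he d
  refine (drawMean_le_sum h0.le (by linarith) (fun a _ => (hρ a).le)
    (bddMeas_estMean h0 h1 hγ hρ he).sq
    (fun a ha y => pow_le_pow_left₀ (hn _) (estMean_zero_le h1 hγ hρ he heM ha y) 2)
    (fun a _ y => pow_le_pow_left₀ (hn _) (estMean_one_le h0 hγ hρ a y) 2)
    (fun a _ y => pow_le_pow_left₀ (hn _) (estMean_two_le h0 hγ hρ a y) 2)).trans ?_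
  -- The estimate is of size `2 / α` only in exploration rounds, which have probability `α`: the
  -- second moment is of order `1 / α`, not `1 / α²`.
  have e1 : α * (2 / α) ^ 2 = 4 / α := by field_simp; norm_num
  rw [← Finset.sum_mul, hs, one_mul, e1]
  have : 0 ≤ α * (2 * (2 * (1 + M))) ^ 2 := by positivity
  linarith

end

end moments

/-! ### Deviation bounds along the play -/

lemma measurable_gft : Measurable fun p : (I × I) × (I × I) => gft p.1 p.2 := by
  unfold gft
  refine Measurable.ite ((measurableSet_le ?_ ?_).inter (measurableSet_le ?_ ?_)) ?_ ?_ <;>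
    fun_prop

lemma measurable_rev : Measurable fun p : (I × I) × (I × I) => rev p.1 p.2 := by
  unfold rev
  refine Measurable.ite ((measurableSet_le ?_ ?_).inter (measurableSet_le ?_ ?_)) ?_ ?_ <;>
    fun_prop

lemma measurable_reward (x : I × I) : Measurable fun e => reward e x := by
  have h1 : Measurable fun e : EnvMove => gft x e.1 :=
    measurable_gft.comp (measurable_const.prodMk measurable_fst)
  have h2 : Measurable fun e : EnvMove => rev x e.1 :=
    measurable_rev.comp (measurable_const.prodMk measurable_fst)
  exact h1.add (measurable_snd.mul h2)

lemma measurable_lagrangian_posted : Measurable fun r => lagrangian r (posted r) := by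
  have h := measurable_posted.prodMk measurable_val
  exact (measurable_gft.comp h).add (measurable_mult.mul (measurable_rev.comp h))

/-- The average under `ρ` of the rewards. -/
def rewardMean (A : Finset (I × I)) (ρ : I × I → ℝ) (e : EnvMove) : ℝ :=
  ∑ x ∈ A, ρ x * reward e x

lemma sum_mul_sub_reward {A : Finset (I × I)} {ρ : I × I → ℝ} (hs : ∑ a ∈ A, ρ a = 1)
    (e : EnvMove) :
    ∑ x ∈ A, ρ x * (3 + e.2 - reward e x) = 3 + e.2 - rewardMean A ρ e := by
  simp only [mul_sub, Finset.sum_sub_distrib, ← Finset.sum_mul, hs, one_mul, rewardMean]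

lemma abs_rewardMean_le {A : Finset (I × I)} {ρ : I × I → ℝ} {M : ℝ} {e : EnvMove}
    (hρ : ∀ a, 0 < ρ a) (hs : ∑ a ∈ A, ρ a = 1) (he : 0 ≤ e.2) (heM : e.2 ≤ M) :
    |rewardMean A ρ e| ≤ 1 + M := by
  calc |rewardMean A ρ e| ≤ ∑ x ∈ A, |ρ x * reward e x| := Finset.abs_sum_le_sum_abs _ _
    _ ≤ ∑ x ∈ A, ρ x * (1 + M) := Finset.sum_le_sum fun x _ => by
        rw [abs_mul, abs_of_pos (hρ x)]
        exact mul_le_mul_of_nonneg_left (abs_reward_le he heM x) (hρ x).le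
    _ = 1 + M := by rw [← Finset.sum_mul, hs, one_mul]

/-- The multipliers of the first `τ` rounds lie in `[0, M]`. -/
def MultLe (M : ℝ) (r : ℕ → Round) (τ : ℕ) : Prop :=
  ∀ t < τ, 0 ≤ mult (r t) ∧ mult (r t) ≤ M

/-- Union bound over `j` and over all `T + 1` values of `τ`. -/
lemma measure_exists_lt_sum_le {A : Finset (I × I)} (hA : A.Nonempty) (η γ M : ℝ) {α : ℝ}
    (h0 : 0 ≤ α) (h1 : α ≤ 1) (env : (n : ℕ) → Kernel (Fin n → Round) EnvMove)
    (henv : ∀ n, IsMarkovKernel (env n)) {ι : Type*} (J : Finset ι)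
    {F : ι → (n : ℕ) → (Fin n → Round) → Round → ℝ}
    (hF : ∀ j ∈ J, ∀ n, Measurable fun p : (Fin n → Round) × Round => F j n p.1 p.2)
    (hexp : ∀ j ∈ J, ∀ n h (e : EnvMove), 0 ≤ e.2 → e.2 ≤ M →
      ∫⁻ d, ENNReal.ofReal (Real.exp (F j n h (e, d))) ∂drawKernel A η γ α n h ≤ 1)
    (T : ℕ) (u : ℝ) :
    (law A η γ α env T).real
      {ω | ∃ τ ≤ T, MultLe M (extend ω) τ ∧ ∃ j ∈ J,
        u < ∑ t ∈ Finset.range τ, F j t (fun i => extend ω i) (extend ω t)} ≤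
      (T + 1) * (J.card * Real.exp (-u)) := by
  have := isProbabilityMeasure_law hA η γ h0 h1 env henv T
  -- Increments are erased in rounds with a multiplier outside `[0, M]`. The exponential bound then
  -- holds for every move, and nothing changes on `MultLe`.
  set G : ι → (n : ℕ) → (Fin n → Round) → Round → ℝ := fun j n h r =>
    {r | 0 ≤ mult r ∧ mult r ≤ M}.indicator (F j n h) r with hG
  have hS : MeasurableSet {r | 0 ≤ mult r ∧ mult r ≤ M} :=
    (measurableSet_le measurable_const measurable_mult).inter
      (measurableSet_le measurable_mult measurable_const)
  have hone : ∀ τ ≤ T, ∀ j ∈ J, (law A η γ α env T).real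
      {ω | u < ∑ t ∈ Finset.range τ, G j t (fun i => extend ω i) (extend ω t)} ≤
      Real.exp (-u) := by
    intro τ hτ j hj
    refine measure_log_lt_sum_le hA η γ h0 h1 env henv (F := G j) (fun n => ?_)
      (fun n h e => ?_) hτ u
    · exact (hF j hj n).indicator (measurable_snd hS)
    · have := isMarkovKernel_drawKernel hA η γ h0 h1 n
      by_cases he : 0 ≤ e.2 ∧ e.2 ≤ M
      · have : ∀ d : Draw, G j n h (e, d) = F j n h (e, d) := fun d =>
          Set.indicator_of_mem (s := {r | 0 ≤ mult r ∧ mult r ≤ M}) he _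
        simp only [this]
        exact hexp j hj n h e he.1 he.2
      · have : ∀ d : Draw, G j n h (e, d) = 0 := fun d =>
          Set.indicator_of_notMem (s := {r | 0 ≤ mult r ∧ mult r ≤ M}) he _
        simp [this]
  have hsub : {ω : Fin T → Round | ∃ τ ≤ T, MultLe M (extend ω) τ ∧ ∃ j ∈ J,
      u < ∑ t ∈ Finset.range τ, F j t (fun i => extend ω i) (extend ω t)} ⊆
      ⋃ τ ∈ Finset.range (T + 1), ⋃ j ∈ J,
        {ω | u < ∑ t ∈ Finset.range τ, G j t (fun i => extend ω i) (extend ω t)} := by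
    rintro ω ⟨τ, hτ, hM, j, hj, hu⟩
    refine Set.mem_biUnion (Finset.mem_coe.2 (Finset.mem_range.2 (by omega : τ < T + 1)))
      (Set.mem_biUnion (Finset.mem_coe.2 hj) ?_)
    refine hu.trans_eq (Finset.sum_congr rfl fun t ht => ?_)
    exact (Set.indicator_of_mem (s := {r | 0 ≤ mult r ∧ mult r ≤ M})
      (hM t (Finset.mem_range.1 ht)) _).symm
  calc _ ≤ _ := measureReal_mono hsub (measure_ne_top _ _)
    _ ≤ ∑ τ ∈ Finset.range (T + 1), ∑ j ∈ J, Real.exp (-u) := by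
      refine (measureReal_biUnion_finset_le _ _).trans (Finset.sum_le_sum fun τ hτ => ?_)
      refine (measureReal_biUnion_finset_le _ _).trans (Finset.sum_le_sum fun j hj => ?_)
      exact hone τ (Nat.lt_succ_iff.1 (Finset.mem_range.1 hτ)) j hj
    _ = _ := by simp

/-! ### The four compensated processes. -/

section processes

variable (A : Finset (I × I)) (η γ α M : ℝ)

/-- A bound for the mean of the implicit exploration bias. -/
def biasBound : ℝ :=
  γ * (2 * ((sellerPrices A).card + (buyerPrices A).card) / α + 2 * (2 * (1 + M)) * A.card)

/-- A bound for the mean of the averaged squared estimates. -/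
def sqBound : ℝ :=
  2 * ((sellerPrices A).card + (buyerPrices A).card) / α + 2 * (2 * (1 + M)) ^ 2 * A.card

/-- Overestimation of the loss of `x`. -/
def overProcess (x : I × I) (n : ℕ) (h : Fin n → Round) (r : Round) : ℝ :=
  γ / (2 * (1 + M)) * (lossEst A α γ (sampling A η γ α n h) r x - (3 + mult r - reward r.1 x))

/-- Underestimation of the loss of the algorithm, with scale `c`. -/
def underProcess (c : ℝ) (n : ℕ) (h : Fin n → Round) (r : Round) : ℝ :=
  c * (3 + mult r - rewardMean A (sampling A η γ α n h) r.1 - biasBound A γ α M -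
    estMean A α γ (sampling A η γ α n h) r) - c ^ 2 * (4 * (2 * (1 + M)) ^ 2 + 4 / α)

/-- Excess of the averaged squared estimates, with scale `c`. -/
def sqProcess (c : ℝ) (n : ℕ) (h : Fin n → Round) (r : Round) : ℝ :=
  c * (estSq A α γ (sampling A η γ α n h) r - 2 * sqBound A α M)

/-- Deficit of the reward of the posted prices, with scale `c`. -/
def postedProcess (c : ℝ) (n : ℕ) (h : Fin n → Round) (r : Round) : ℝ :=
  c * (rewardMean A (sampling A η γ α n h) r.1 - lagrangian r (posted r) -
    2 * α * (1 + M)) - c ^ 2 * (2 * (1 + M)) ^ 2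

lemma measurable_sampling_fst (n : ℕ) (a : I × I) :
    Measurable fun p : (Fin n → Round) × Round => sampling A η γ α n p.1 a :=
  (measurable_sampling A η γ α n a).comp measurable_fst

lemma measurable_lossEst_sampling (n : ℕ) (x : I × I) :
    Measurable fun p : (Fin n → Round) × Round =>
      lossEst A α γ (sampling A η γ α n p.1) p.2 x :=
  measurable_lossEst A α γ x (measurable_sampling_fst A η γ α n) measurable_snd

lemma measurable_reward_snd {n : ℕ} (x : I × I) :
    Measurable fun p : (Fin n → Round) × Round => reward p.2.1 x :=
  (measurable_reward x).comp (measurable_fst.comp measurable_snd)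

lemma measurable_rewardMean (n : ℕ) : Measurable fun p : (Fin n → Round) × Round =>
    rewardMean A (sampling A η γ α n p.1) p.2.1 :=
  Finset.measurable_sum _ fun x _ =>
    (measurable_sampling_fst A η γ α n x).mul (measurable_reward_snd x)

lemma measurable_overProcess (x : I × I) (n : ℕ) :
    Measurable fun p : (Fin n → Round) × Round => overProcess A η γ α M x n p.1 p.2 := by
  have h1 := measurable_lossEst_sampling A η γ α n x
  have h2 := measurable_reward_snd (n := n) x
  have h3 : Measurable fun p : (Fin n → Round) × Round => mult p.2 :=
    measurable_mult.comp measurable_snd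
  exact (h1.sub ((h3.const_add 3).sub h2)).const_mul _

lemma measurable_underProcess (c : ℝ) (n : ℕ) :
    Measurable fun p : (Fin n → Round) × Round => underProcess A η γ α M c n p.1 p.2 := by
  have h1 : Measurable fun p : (Fin n → Round) × Round =>
      estMean A α γ (sampling A η γ α n p.1) p.2 := Finset.measurable_sum _ fun x _ =>
    (measurable_sampling_fst A η γ α n x).mul (measurable_lossEst_sampling A η γ α n x)
  have h2 := measurable_rewardMean A η γ α n
  have h3 : Measurable fun p : (Fin n → Round) × Round => mult p.2 :=
    measurable_mult.comp measurable_snd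
  exact (((((h3.const_add 3).sub h2).sub_const _).sub h1).const_mul _).sub_const _

lemma measurable_sqProcess (c : ℝ) (n : ℕ) :
    Measurable fun p : (Fin n → Round) × Round => sqProcess A η γ α M c n p.1 p.2 := by
  have h1 : Measurable fun p : (Fin n → Round) × Round =>
      estSq A α γ (sampling A η γ α n p.1) p.2 := Finset.measurable_sum _ fun x _ =>
    (measurable_sampling_fst A η γ α n x).mul
      ((measurable_lossEst_sampling A η γ α n x).pow_const 2)
  exact (h1.sub_const _).const_mul _

lemma measurable_postedProcess (c : ℝ) (n : ℕ) :
    Measurable fun p : (Fin n → Round) × Round => postedProcess A η γ α M c n p.1 p.2 := by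
  have h2 := measurable_rewardMean A η γ α n
  have h3 : Measurable fun p : (Fin n → Round) × Round => lagrangian p.2 (posted p.2) :=
    measurable_lagrangian_posted.comp measurable_snd
  exact (((h2.sub h3).sub_const _).const_mul _).sub_const _

end processes

/-! ### Exponential moment bounds for the four processes. -/

section exponential

variable {A : Finset (I × I)} {γ α M : ℝ} {e : EnvMove}

lemma lintegral_exp_overProcess_le_one (η : ℝ) (hγ : 0 < γ) (h0 : 0 < α) (h1 : α ≤ 1 / 2)
    {x : I × I} (hx : x ∈ A) (n : ℕ) (h : Fin n → Round) (he : 0 ≤ e.2) (heM : e.2 ≤ M) :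
    ∫⁻ d, ENNReal.ofReal (Real.exp (overProcess A η γ α M x n h (e, d)))
      ∂drawKernel A η γ α n h ≤ 1 := by
  have hA : A.Nonempty := ⟨x, hx⟩
  have hρ := sampling_pos hA η γ α n h
  have hρ' : ∀ a ∈ A, 0 ≤ sampling A η γ α n h a := fun a _ => (hρ a).le
  have hα : α ≤ 1 := by linarith
  have hB : 0 < 2 * (1 + M) := by linarith
  have hc : 0 < γ / (2 * (1 + M)) := by positivity
  have hb := bddMeas_lossEst h0.le hα hγ hρ' he hx
  have key := mul_le_mul_of_nonneg_left
    (drawMean_lossEst_add_sq_le h0.le hα hγ hρ' he heM hx) hc.le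
  have := lintegral_exp_sub_le_one hA η γ h0.le hα n h (hb.const_mul (γ / (2 * (1 + M))))
    (fun a _ i y => ?_) (m := γ / (2 * (1 + M)) * (3 + e.2 - reward e x)) ?_
  · simp only [← mul_sub] at this
    exact this
  · refine (mul_le_mul_of_nonneg_left (lossEst_le h0.le hα hγ hρ' he heM hx _) hc.le).trans ?_
    rw [div_mul_div_comm, mul_comm γ, div_self (mul_pos hB hγ).ne']
  · simp only [mul_pow, drawMean_const_mul]
    refine le_trans (le_of_eq ?_) key
    ring

lemma lintegral_exp_underProcess_le_one (hA : A.Nonempty) (η : ℝ) (hγ : 0 < γ) (h0 : 0 < α)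
    (h1 : α ≤ 1 / 2) {c : ℝ} (hc : 0 ≤ c) (n : ℕ) (h : Fin n → Round) (he : 0 ≤ e.2)
    (heM : e.2 ≤ M) :
    ∫⁻ d, ENNReal.ofReal (Real.exp (underProcess A η γ α M c n h (e, d)))
      ∂drawKernel A η γ α n h ≤ 1 := by
  have hρ := sampling_pos hA η γ α n h
  have hs := sum_sampling hA η γ α n h
  have hα : α ≤ 1 := by linarith
  have k1 := mul_le_mul_of_nonneg_left
    (drawMean_estMean_ge (A := A) h0 h1 hγ hρ he heM) hc
  have k2 := mul_le_mul_of_nonneg_left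
    (drawMean_estMean_sq_le h0 h1 hγ hρ hs he heM) (sq_nonneg c)
  rw [sum_mul_sub_reward hs] at k1
  have := lintegral_exp_sub_le_one hA η γ h0.le hα n h
    ((bddMeas_estMean (A := A) h0 h1 hγ hρ he).const_mul (-c)) (fun a _ i y => ?_)
    (m := -c * (3 + e.2 - rewardMean A (sampling A η γ α n h) e - biasBound A γ α M) +
      c ^ 2 * (4 * (2 * (1 + M)) ^ 2 + 4 / α)) ?_
  · refine le_of_eq_of_le (lintegral_congr fun d => ?_) this
    rw [underProcess]
    change ENNReal.ofReal (Real.exp (c * (3 + e.2 - rewardMean A (sampling A η γ α n h) e -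
      biasBound A γ α M - _) - _)) = _
    congr 2
    ring
  · have := mul_nonneg hc (estMean_nonneg (A := A) h0 hγ hρ hα he (a, i, y))
    linarith
  · simp only [mul_pow, drawMean_const_mul, neg_sq]
    rw [biasBound]
    linarith

lemma lintegral_exp_sqProcess_le_one (hA : A.Nonempty) (η : ℝ) (hγ : 0 < γ) (h0 : 0 < α)
    (h1 : α ≤ 1 / 2) {c : ℝ} (hc : 0 ≤ c) (hc1 : c * ((2 * (2 * (1 + M)) ^ 2 + 2 / α) / γ) ≤ 1)
    (n : ℕ) (h : Fin n → Round) (he : 0 ≤ e.2) (heM : e.2 ≤ M) :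
    ∫⁻ d, ENNReal.ofReal (Real.exp (sqProcess A η γ α M c n h (e, d)))
      ∂drawKernel A η γ α n h ≤ 1 := by
  have hρ := sampling_pos hA η γ α n h
  have hα : α ≤ 1 := by linarith
  have hb := (bddMeas_estSq (A := A) h0 h1 hγ hρ he).const_mul c
  have hX0 : ∀ d, 0 ≤ c * estSq A α γ (sampling A η γ α n h) (e, d) := fun d =>
    mul_nonneg hc (Finset.sum_nonneg fun x _ => mul_nonneg (hρ x).le (sq_nonneg _))
  have hX1 : ∀ a ∈ A, ∀ i y, c * estSq A α γ (sampling A η γ α n h) (e, a, i, y) ≤ 1 := by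
    intro a ha i y
    refine (mul_le_mul_of_nonneg_left ?_ hc).trans hc1
    have p1 : 0 ≤ 2 / α / γ := by positivity
    have p2 : 0 ≤ 2 * (2 * (1 + M)) ^ 2 / γ := by positivity
    rw [add_div]
    fin_cases i
    · exact (estSq_zero_le h1 hγ hρ he heM ha y).trans (by linarith)
    · exact (estSq_one_le h0 hγ hρ a y).trans (by linarith)
    · exact (estSq_two_le h0 hγ hρ a y).trans (by linarith)
  -- A variable in `[0, 1]` dominates its square, so mean plus second moment is at most twice the
  -- mean. This is the factor `2` before `sqBound`.
  have hsq : drawMean A α (sampling A η γ α n h)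
      (fun d => (c * estSq A α γ (sampling A η γ α n h) (e, d)) ^ 2) ≤
      drawMean A α (sampling A η γ α n h)
        fun d => c * estSq A α γ (sampling A η γ α n h) (e, d) :=
    drawMean_mono h0.le hα (fun a _ => (hρ a).le) hb.sq hb fun a ha i y => by
      rw [sq]
      exact mul_le_of_le_one_left (hX0 _) (hX1 a ha i y)
  have k1 := mul_le_mul_of_nonneg_left
    (drawMean_estSq_le (A := A) h0 h1 hγ hρ he heM) hc
  have := lintegral_exp_sub_le_one hA η γ h0.le hα n h hb hX1
    (m := c * (2 * sqBound A α M)) ?_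
  · simp only [← mul_sub] at this
    exact this
  · refine (add_le_add_right hsq _).trans ?_
    rw [drawMean_const_mul, sqBound]
    linarith

lemma lintegral_exp_postedProcess_le_one (hA : A.Nonempty) (η : ℝ) (h0 : 0 < α)
    (h1 : α ≤ 1) {c : ℝ} (hc : 0 ≤ c) (hc1 : c * (2 * (1 + M)) ≤ 1)
    (n : ℕ) (h : Fin n → Round) (he : 0 ≤ e.2) (heM : e.2 ≤ M) :
    ∫⁻ d, ENNReal.ofReal (Real.exp (postedProcess A η γ α M c n h (e, d)))
      ∂drawKernel A η γ α n h ≤ 1 := by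
  have hρ := sampling_pos hA η γ α n h
  have hs := sum_sampling hA η γ α n h
  set V := rewardMean A (sampling A η γ α n h) e with hV
  have hVb := abs_le.1 (abs_rewardMean_le hρ hs he heM)
  have hL : ∀ d : Draw, -(1 + M) ≤ lagrangian (e, d) (posted (e, d)) ∧
      lagrangian (e, d) (posted (e, d)) ≤ 1 + M := fun d =>
    abs_le.1 (abs_reward_le he heM (posted (e, d)))
  have habs : ∀ d : Draw, |c * (V - lagrangian (e, d) (posted (e, d)))| ≤
      c * (2 * (1 + M)) := fun d => by
    rw [abs_mul, abs_of_nonneg hc]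
    refine mul_le_mul_of_nonneg_left (abs_le.2 ?_) hc
    constructor <;> linarith [(hL d).1, (hL d).2, hVb.1, hVb.2]
  have hb : BddMeas fun d => c * (V - lagrangian (e, d) (posted (e, d))) :=
    ⟨((measurable_lagrangian_posted.comp measurable_prodMk_left).const_sub V).const_mul c,
      _, habs⟩
  have hsq : drawMean A α (sampling A η γ α n h)
      (fun d => (c * (V - lagrangian (e, d) (posted (e, d)))) ^ 2) ≤
      c ^ 2 * (2 * (1 + M)) ^ 2 := by
    rw [← drawMean_const (α := α) hs (c ^ 2 * (2 * (1 + M)) ^ 2), ← mul_pow]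
    refine drawMean_mono h0.le h1 (fun a _ => (hρ a).le) hb.sq (BddMeas.const _)
      fun a _ i y => ?_
    rw [← sq_abs]
    exact pow_le_pow_left₀ (abs_nonneg _) (habs _) 2
  have hmean : drawMean A α (sampling A η γ α n h)
      (fun d => c * (V - lagrangian (e, d) (posted (e, d)))) ≤ c * (2 * α * (1 + M)) := by
    refine (drawMean_le_sum h0.le h1 (fun a _ => (hρ a).le) hb
      (b₀ := fun a => c * (V - reward e a)) (b₁ := c * (2 * (1 + M)))
      (fun a _ y => le_rfl) (fun a _ y => (le_abs_self _).trans (habs _))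
      (fun a _ y => (le_abs_self _).trans (habs _))).trans (le_of_eq ?_)
    -- Under `H = 0` the deviation from `V` averages to zero over the sampling distribution; only
    -- the share `α` of exploration rounds remains.
    have e1 : ∀ a, sampling A η γ α n h a * ((1 - α) * (c * (V - reward e a)) +
        α * (c * (2 * (1 + M)))) = sampling A η γ α n h a *
          ((1 - α) * c * V + α * (c * (2 * (1 + M)))) -
        (1 - α) * c * (sampling A η γ α n h a * reward e a) := fun a => by ring
    simp only [e1]
    rw [Finset.sum_sub_distrib, ← Finset.sum_mul, hs, ← Finset.mul_sum, hV, rewardMean]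
    ring
  have := lintegral_exp_sub_le_one hA η γ h0.le h1 n h hb
    (fun a _ i y => (le_abs_self _).trans ((habs _).trans hc1))
    (m := c * (2 * α * (1 + M)) + c ^ 2 * (2 * (1 + M)) ^ 2) (add_le_add hmean hsq)
  refine le_of_eq_of_le (lintegral_congr fun d => ?_) this
  rw [postedProcess]
  change ENNReal.ofReal (Real.exp (c * (V - _ - _) - _)) = _
  congr 2
  ring

end exponential

/-! ### The regret bound -/

lemma regret_eq {A : Finset (I × I)} {T : ℕ} (ω : Fin T → Round) {τ : ℕ} (hτ : τ ≤ T)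
    (π : I × I → ℝ) :
    regret A ω τ π =
      ∑ t ∈ Finset.range τ, ∑ x ∈ A, π x * lagrangian (extend ω t) x -
        ∑ t ∈ Finset.range τ, lagrangian (extend ω t) (posted (extend ω t)) := by
  have key : ∀ f : Round → ℝ, ∑ t : Fin T with t.val < τ, f (ω t) =
      ∑ t ∈ Finset.range τ, f (extend ω t) := by
    intro f
    have h1 := Fin.sum_univ_eq_sum_range (fun t => if t < τ then f (extend ω t) else 0) T
    simp only [extend_coe] at h1
    rw [Finset.sum_filter, h1, ← Finset.sum_filter]
    congr 1
    ext t
    simp only [Finset.mem_filter, Finset.mem_range]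
    omega
  rw [regret, key fun r => ∑ x ∈ A, π x * lagrangian r x,
    key fun r => lagrangian r (posted r)]

/-- Regret is affine in `π`, so pointwise bounds on the vertices hold simultaneously for all
distributions; no union bound over `π` is needed. -/
lemma regret_le_of_forall {A : Finset (I × I)} {T : ℕ} (ω : Fin T → Round) {τ : ℕ}
    (hτ : τ ≤ T) {π : I × I → ℝ} (hπ : ∀ x ∈ A, 0 ≤ π x) (hπ1 : ∑ x ∈ A, π x = 1) {b : ℝ}
    (hb : ∀ x ∈ A, ∑ t ∈ Finset.range τ, lagrangian (extend ω t) x -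
      ∑ t ∈ Finset.range τ, lagrangian (extend ω t) (posted (extend ω t)) ≤ b) :
    regret A ω τ π ≤ b := by
  rw [regret_eq ω hτ, Finset.sum_comm]
  calc _ = ∑ x ∈ A, π x * (∑ t ∈ Finset.range τ, lagrangian (extend ω t) x -
      ∑ t ∈ Finset.range τ, lagrangian (extend ω t) (posted (extend ω t))) := by
        simp only [mul_sub, Finset.sum_sub_distrib, ← Finset.sum_mul, hπ1, one_mul]
        simp only [Finset.mul_sum]
    _ ≤ ∑ x ∈ A, π x * b :=
        Finset.sum_le_sum fun x hx => mul_le_mul_of_nonneg_left (hb x hx) (hπ x hx)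
    _ = b := by rw [← Finset.sum_mul, hπ1, one_mul]

/-- The trivial bound on the regret. -/
lemma sum_lagrangian_sub_le {M : ℝ} (hM : 0 ≤ M) {r : ℕ → Round} {T τ : ℕ} (hτ : τ ≤ T)
    (hr : MultLe M r τ) (x : I × I) :
    ∑ t ∈ Finset.range τ, lagrangian (r t) x -
      ∑ t ∈ Finset.range τ, lagrangian (r t) (posted (r t)) ≤ 2 * (1 + M) * T := by
  rw [← Finset.sum_sub_distrib]
  calc _ ≤ ∑ t ∈ Finset.range τ, 2 * (1 + M) := by
        refine Finset.sum_le_sum fun t ht => ?_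
        obtain ⟨h0, h1⟩ := hr t (Finset.mem_range.1 ht)
        have k1 := (abs_le.1 (abs_reward_le (e := (r t).1) h0 h1 x)).2
        have k2 := (abs_le.1 (abs_reward_le (e := (r t).1) h0 h1 (posted (r t)))).1
        change reward (r t).1 x - reward (r t).1 (posted (r t)) ≤ _
        linarith
    _ = 2 * (1 + M) * τ := by simp [mul_comm]
    _ ≤ _ := by
        have : (τ : ℝ) ≤ T := by exact_mod_cast hτ
        gcongr

/-- Deterministic part of the argument. The brackets in the bound are, in order, overestimation of
the loss of `x`, underestimation of the mean loss, the exponential weights regret with its squares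
bounded through `k3`, and the gap between sampled and posted rewards. -/
lemma sum_lagrangian_sub_le_of_processes {A : Finset (I × I)} {η γ α M u c₂ c₃ c₄ : ℝ}
    (hη : 0 < η) (hγ : 0 < γ) (h0 : 0 < α) (h1 : α ≤ 1) (hM : 0 ≤ M) (hc₂ : 0 < c₂)
    (hc₃ : 0 < c₃) (hc₄ : 0 < c₄) {r : ℕ → Round} {T τ : ℕ} (hτ : τ ≤ T) (hr : MultLe M r τ)
    {x : I × I} (hx : x ∈ A)
    (k1 : ∑ t ∈ Finset.range τ, overProcess A η γ α M x t (fun i => r i) (r t) ≤ u)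
    (k2 : ∑ t ∈ Finset.range τ, underProcess A η γ α M c₂ t (fun i => r i) (r t) ≤ u)
    (k3 : ∑ t ∈ Finset.range τ, sqProcess A η γ α M c₃ t (fun i => r i) (r t) ≤ u)
    (k4 : ∑ t ∈ Finset.range τ, postedProcess A η γ α M c₄ t (fun i => r i) (r t) ≤ u) :
    ∑ t ∈ Finset.range τ, lagrangian (r t) x -
      ∑ t ∈ Finset.range τ, lagrangian (r t) (posted (r t)) ≤
      2 * (1 + M) / γ * u +
      (T * biasBound A γ α M + (u + T * (c₂ ^ 2 * (4 * (2 * (1 + M)) ^ 2 + 4 / α))) / c₂) +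
      (Real.log A.card / η + η * (2 * T * sqBound A α M + u / c₃)) +
      (T * (2 * α * (1 + M)) + (u + T * (c₄ ^ 2 * (2 * (1 + M)) ^ 2)) / c₄) := by
  have hA : A.Nonempty := ⟨x, hx⟩
  have hB : 0 < 2 * (1 + M) := by linarith
  have hτ' : (τ : ℝ) ≤ T := by exact_mod_cast hτ
  set ρ : ℕ → I × I → ℝ := fun t => sampling A η γ α t fun i => r i with hρ
  -- Histories are prefixes of one sequence `r`, so the weight recursion holds by `rfl`.
  have hhedge := sum_normalize_sub_le hA hη (l := fun t x => lossEst A α γ (ρ t) (r t) x)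
    (w := fun t x => weight A η γ α t (fun i => r i) x) τ
    (fun t ht y hy => lossEst_nonneg h0.le h1 hγ
      (fun a _ => (sampling_pos hA η γ α t _ a).le) (e := (r t).1) (hr t ht).1 hy (r t).2)
    (fun _ => rfl) (fun t y => rfl) hx
  change ∑ t ∈ Finset.range τ, estMean A α γ (ρ t) (r t) -
    ∑ t ∈ Finset.range τ, lossEst A α γ (ρ t) (r t) x ≤ Real.log A.card / η +
      η * ∑ t ∈ Finset.range τ, estSq A α γ (ρ t) (r t) at hhedge
  simp only [overProcess] at k1
  simp only [underProcess] at k2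
  simp only [sqProcess] at k3
  simp only [postedProcess] at k4
  rw [← Finset.mul_sum] at k1 k3
  rw [Finset.sum_sub_distrib, ← Finset.mul_sum] at k2 k4
  have d1 : ∑ t ∈ Finset.range τ, (lossEst A α γ (ρ t) (r t) x -
      (3 + mult (r t) - reward (r t).1 x)) ≤ 2 * (1 + M) / γ * u := by
    rw [div_mul_eq_mul_div, div_le_iff₀ hB] at k1
    rw [div_mul_eq_mul_div, le_div_iff₀ hγ]
    linarith
  have d2 : ∑ t ∈ Finset.range τ, (3 + mult (r t) - rewardMean A (ρ t) (r t).1 -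
      biasBound A γ α M - estMean A α γ (ρ t) (r t)) ≤
      (u + T * (c₂ ^ 2 * (4 * (2 * (1 + M)) ^ 2 + 4 / α))) / c₂ := by
    rw [le_div_iff₀' hc₂]
    simp only [Finset.sum_const, Finset.card_range, nsmul_eq_mul] at k2
    have : (τ : ℝ) * (c₂ ^ 2 * (4 * (2 * (1 + M)) ^ 2 + 4 / α)) ≤
      T * (c₂ ^ 2 * (4 * (2 * (1 + M)) ^ 2 + 4 / α)) :=
        mul_le_mul_of_nonneg_right hτ' (by positivity)
    linarith
  have d3 : ∑ t ∈ Finset.range τ, (estSq A α γ (ρ t) (r t) - 2 * sqBound A α M) ≤ u / c₃ := by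
    rw [le_div_iff₀' hc₃]
    exact k3
  have d4 : ∑ t ∈ Finset.range τ, (rewardMean A (ρ t) (r t).1 -
      lagrangian (r t) (posted (r t)) - 2 * α * (1 + M)) ≤
      (u + T * (c₄ ^ 2 * (2 * (1 + M)) ^ 2)) / c₄ := by
    rw [le_div_iff₀' hc₄]
    simp only [Finset.sum_const, Finset.card_range, nsmul_eq_mul] at k4
    have : (τ : ℝ) * (c₄ ^ 2 * (2 * (1 + M)) ^ 2) ≤ T * (c₄ ^ 2 * (2 * (1 + M)) ^ 2) :=
        mul_le_mul_of_nonneg_right hτ' (by positivity)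
    linarith
  simp only [Finset.sum_sub_distrib, Finset.sum_add_distrib, Finset.sum_const,
    Finset.card_range, nsmul_eq_mul] at d1 d2 d3 d4
  have p1 : (τ : ℝ) * biasBound A γ α M ≤ T * biasBound A γ α M :=
    mul_le_mul_of_nonneg_right hτ' (by unfold biasBound; positivity)
  have p2 : (τ : ℝ) * (2 * sqBound A α M) ≤ T * (2 * sqBound A α M) :=
    mul_le_mul_of_nonneg_right hτ' (by unfold sqBound; positivity)
  have p3 : (τ : ℝ) * (2 * α * (1 + M)) ≤ T * (2 * α * (1 + M)) :=
    mul_le_mul_of_nonneg_right hτ' (by positivity)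
  have p4 := mul_le_mul_of_nonneg_left (show ∑ t ∈ Finset.range τ, estSq A α γ (ρ t) (r t) ≤
    2 * T * sqBound A α M + u / c₃ by linarith) hη.le
  change ∑ t ∈ Finset.range τ, reward (r t).1 x - _ ≤ _
  linarith

/-- The error terms are dominated by the claimed bound when the parameters are tuned. Here
`n`, `q` are the square roots of the number of prices and of the horizon, `K` counts the
prices of both sides, and `L` is the logarithm of the horizon. -/
lemma tuned_bound_le {n q K α M L l : ℝ} (hn : 1 ≤ n) (hq : 1 ≤ q) (hK : n ≤ K) (h0 : 0 < α)
    (hM : 1 ≤ M) (hL : 1 / 2 ≤ L) (hl : l ≤ L) :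
    2 * (1 + M) / (1 / (n * q)) * (4 * L) +
      (q ^ 2 * (1 / (n * q) * (2 * K / α + 2 * (2 * (1 + M)) * n ^ 2)) +
        (4 * L + q ^ 2 * ((1 / (M * q)) ^ 2 * (4 * (2 * (1 + M)) ^ 2 + 4 / α))) /
          (1 / (M * q))) +
      (l / (1 / (M * (n * q))) + 1 / (M * (n * q)) *
        (2 * q ^ 2 * (2 * K / α + 2 * (2 * (1 + M)) ^ 2 * n ^ 2) +
          4 * L / (1 / (n * q) / (2 * (2 * (1 + M)) ^ 2 + 2 / α)))) +
      (q ^ 2 * (2 * α * (1 + M)) +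
        (4 * L + q ^ 2 * ((1 / (2 * (1 + M) * q)) ^ 2 * (2 * (1 + M)) ^ 2)) /
          (1 / (2 * (1 + M) * q))) ≤
    500 * L * (M * (n * q + K / n * (q / α) + α * q ^ 2)) := by
  have hn0 : 0 < n := by linarith
  have hq0 : 0 < q := by linarith
  have hM0 : 0 < M := by linarith
  have hL0 : 0 < L := by linarith
  have hM1 : 0 < 1 + M := by linarith
  set s := n * q with hs
  set W := K / n * (q / α) with hW
  have hs0 : 0 < s := by positivity
  have hqs : q ≤ s := by rw [hs]; nlinarith
  have hs1 : 1 ≤ s := hq.trans hqs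
  have hW0 : 0 < W := by have : 0 < K := by linarith
                         positivity
  -- `K ≥ n` is what lets the lower-order terms `q / α` and `1 / α` be absorbed into `W`.
  have hKn : 1 ≤ K / n := (one_le_div hn0).2 hK
  have hqW : q / α ≤ W := le_mul_of_one_le_left (by positivity) hKn
  have hαW : 1 / α ≤ W := (div_le_div_of_nonneg_right hq h0.le).trans hqW
  have hB : 2 * (1 + M) ≤ 4 * M := by linarith
  have hB2 : (2 * (1 + M)) ^ 2 ≤ 16 * M ^ 2 := by nlinarith
  have hMs : 0 < M * s := by positivity
  have hLM : M * s ≤ 2 * (L * (M * s)) := by nlinarith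
  have hLW : W ≤ 2 * (L * W) := by nlinarith
  have hMW : L * W ≤ L * (M * W) := by
    refine mul_le_mul_of_nonneg_left ?_ hL0.le; nlinarith
  have t1 : 2 * (1 + M) / (1 / s) * (4 * L) ≤ 16 * (L * (M * s)) := by
    have : 2 * (1 + M) / (1 / s) * (4 * L) = 2 * (1 + M) * (4 * (s * L)) := by field_simp
    rw [this]
    have := mul_le_mul_of_nonneg_right hB (show 0 ≤ 4 * (s * L) by positivity)
    linarith
  have t2 : q ^ 2 * (1 / s * (2 * K / α + 2 * (2 * (1 + M)) * n ^ 2)) ≤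
      2 * W + 8 * (M * s) := by
    have : q ^ 2 * (1 / s * (2 * K / α + 2 * (2 * (1 + M)) * n ^ 2)) =
        2 * W + 2 * (2 * (1 + M)) * s := by rw [hW, hs]; field_simp
    rw [this]
    have := mul_le_mul_of_nonneg_right hB hs0.le
    linarith
  have t3 : (4 * L + q ^ 2 * ((1 / (M * q)) ^ 2 * (4 * (2 * (1 + M)) ^ 2 + 4 / α))) /
      (1 / (M * q)) ≤ 4 * (L * (M * s)) + 64 * (M * s) + 4 * W := by
    have e1 : (4 * L + q ^ 2 * ((1 / (M * q)) ^ 2 * (4 * (2 * (1 + M)) ^ 2 + 4 / α))) /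
      (1 / (M * q)) = 4 * L * M * q + 4 * (q / M) * (2 * (1 + M)) ^ 2 +
        4 * (q / α / M) := by field_simp; ring
    rw [e1]
    have a1 := mul_le_mul_of_nonneg_left hqs (show 0 ≤ 4 * L * M by positivity)
    have a2 := mul_le_mul_of_nonneg_left hB2 (show 0 ≤ 4 * (q / M) by positivity)
    have a3 : 4 * (q / M) * (16 * M ^ 2) = 64 * (M * q) := by field_simp; norm_num
    have a4 := mul_le_mul_of_nonneg_left hqs hM0.le
    have a5 : q / α / M ≤ q / α := div_le_self (by positivity) hM
    linarith
  have t4 : l / (1 / (M * s)) ≤ L * (M * s) := by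
    rw [div_div_eq_mul_div, div_one]
    exact mul_le_mul_of_nonneg_right hl hMs.le
  have t5 : 1 / (M * s) * (2 * q ^ 2 * (2 * K / α + 2 * (2 * (1 + M)) ^ 2 * n ^ 2) +
      4 * L / (1 / s / (2 * (2 * (1 + M)) ^ 2 + 2 / α))) ≤
      4 * W + 64 * (M * s) + 128 * (L * (M * s)) + 8 * (L * W) := by
    have e1 : 1 / (M * s) * (2 * q ^ 2 * (2 * K / α + 2 * (2 * (1 + M)) ^ 2 * n ^ 2) +
      4 * L / (1 / s / (2 * (2 * (1 + M)) ^ 2 + 2 / α))) =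
      4 * (W / M) + (4 * (s / M) + 8 * (L / M)) * (2 * (1 + M)) ^ 2 +
        8 * L * (1 / α / M) := by rw [hW, hs]; field_simp; ring
    rw [e1]
    have a1 : W / M ≤ W := div_le_self hW0.le hM
    have a2 := mul_le_mul_of_nonneg_left hB2
      (show 0 ≤ 4 * (s / M) + 8 * (L / M) by positivity)
    have a3 : (4 * (s / M) + 8 * (L / M)) * (16 * M ^ 2) = 64 * (M * s) + 128 * (L * M) := by
      field_simp; ring
    have a4 : L * M ≤ L * (M * s) :=
      mul_le_mul_of_nonneg_left (le_mul_of_one_le_right hM0.le hs1) hL0.le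
    have a5 : 1 / α / M ≤ W := (div_le_self (by positivity) hM).trans hαW
    have a6 := mul_le_mul_of_nonneg_left a5 (show 0 ≤ 8 * L by positivity)
    linarith
  have t6 : q ^ 2 * (2 * α * (1 + M)) ≤ 8 * (L * (M * (α * q ^ 2))) := by
    have a1 := mul_le_mul_of_nonneg_left hB (show 0 ≤ α * q ^ 2 by positivity)
    have a2 := mul_le_mul_of_nonneg_right hL (show 0 ≤ M * (α * q ^ 2) by positivity)
    linarith
  have t7 : (4 * L + q ^ 2 * ((1 / (2 * (1 + M) * q)) ^ 2 * (2 * (1 + M)) ^ 2)) /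
      (1 / (2 * (1 + M) * q)) ≤ 16 * (L * (M * s)) + 4 * (M * s) := by
    have e1 : (4 * L + q ^ 2 * ((1 / (2 * (1 + M) * q)) ^ 2 * (2 * (1 + M)) ^ 2)) /
      (1 / (2 * (1 + M) * q)) = (4 * L + 1) * q * (2 * (1 + M)) := by field_simp
    rw [e1]
    have a1 := mul_le_mul_of_nonneg_left hB (show 0 ≤ (4 * L + 1) * q by positivity)
    have a2 := mul_le_mul_of_nonneg_left hqs (show 0 ≤ (4 * L + 1) * (4 * M) by positivity)
    linarith
  -- After terms without `L` are doubled through `L ≥ 1/2`, the coefficients are 445 for `L * (M *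
  -- s)`, 28 for the `W` term and 8 for the `α` term.
  have hfin : 500 * L * (M * (s + W + α * q ^ 2)) =
      500 * (L * (M * s)) + 500 * (L * (M * W)) + 500 * (L * (M * (α * q ^ 2))) := by ring
  rw [hfin]
  have z1 : 0 ≤ L * (M * (α * q ^ 2)) := by positivity
  have z2 : 0 ≤ L * (M * W) := by positivity
  linarith

/-- `A` lies in the product of its price sets, and `|A_s| |A_b| ≤ (|A_s| + |A_b|)²`. It supplies the
hypothesis `n ≤ K` of `tuned_bound_le`. -/
lemma sqrt_card_le {A : Finset (I × I)} :
    √(A.card : ℝ) ≤ ((sellerPrices A).card : ℝ) + (buyerPrices A).card := by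
  rw [Real.sqrt_le_left (by positivity)]
  have h1 : A ⊆ sellerPrices A ×ˢ buyerPrices A := fun x hx =>
    Finset.mem_product.2 ⟨Finset.mem_image_of_mem _ hx, Finset.mem_image_of_mem _ hx⟩
  have h2 : (A.card : ℝ) ≤ (sellerPrices A).card * (buyerPrices A).card := by
    exact_mod_cast (Finset.card_le_card h1).trans_eq (Finset.card_product _ _)
  have h3 : (0 : ℝ) ≤ (sellerPrices A).card := Nat.cast_nonneg _
  have h4 : (0 : ℝ) ≤ (buyerPrices A).card := Nat.cast_nonneg _
  nlinarith

/-- The claimed bound on the regret. -/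
def regretBound (A : Finset (I × I)) (T : ℕ) (α M : ℝ) : ℝ :=
  500 * Real.log T ^ 1 *
    (M * (√((A.card : ℝ) * T) +
      (((sellerPrices A).card : ℝ) + (buyerPrices A).card) / √(A.card : ℝ) * (√(T : ℝ) / α) +
      α * T))

lemma half_le_log {T : ℕ} (hT : 2 ≤ T) : 1 / 2 ≤ Real.log T := by
  have h1 : Real.log 2 ≤ Real.log T := Real.log_le_log (by norm_num) (by exact_mod_cast hT)
  linarith [Real.log_two_gt_d9]

lemma mul_le_regretBound_of_trivial {A : Finset (I × I)} {T : ℕ} {α M : ℝ} (hT : 2 ≤ T)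
    (h0 : 0 < α) (hM : 1 ≤ M) (h : 1 / 2 < α ∨ T ≤ A.card) :
    2 * (1 + M) * T ≤ regretBound A T α M := by
  have hL := half_le_log hT
  have hT0 : (0 : ℝ) ≤ T := Nat.cast_nonneg T
  have hmain : (T : ℝ) / 2 ≤ √((A.card : ℝ) * T) +
      (((sellerPrices A).card : ℝ) + (buyerPrices A).card) / √(A.card : ℝ) * (√(T : ℝ) / α) +
      α * T := by
    have hmid : 0 ≤ (((sellerPrices A).card : ℝ) + (buyerPrices A).card) / √(A.card : ℝ) *
      (√(T : ℝ) / α) := by positivity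
    have hr : 0 ≤ √((A.card : ℝ) * T) := Real.sqrt_nonneg _
    rcases h with h | h
    · have := mul_le_mul_of_nonneg_right h.le hT0
      linarith
    · have h1 : (T : ℝ) ≤ A.card := by exact_mod_cast h
      have h2 : (T : ℝ) ≤ √((A.card : ℝ) * T) := by
        refine Real.le_sqrt_of_sq_le ?_
        rw [sq]
        exact mul_le_mul_of_nonneg_right h1 hT0
      have : 0 ≤ α * T := by positivity
      linarith
  rw [regretBound, pow_one]
  have h1 := mul_le_mul_of_nonneg_left hmain (show 0 ≤ M by linarith)
  have h2 : 500 * (1 / 2) ≤ 500 * Real.log T := by linarith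
  have h3 := mul_le_mul h2 h1 (by positivity) (by linarith)
  have h4 : 0 ≤ (M - 1) * T := mul_nonneg (by linarith) hT0
  have h5 : 0 ≤ M * T := by positivity
  linarith

lemma regret_le_of_trivial {A : Finset (I × I)} {T : ℕ} {α M : ℝ}
    (hM : 0 ≤ M) (h : 2 * (1 + M) * T ≤ regretBound A T α M) (ω : Fin T → Round) {τ : ℕ}
    (hτ : τ ≤ T) (hr : MultLe M (extend ω) τ) {π : I × I → ℝ} (hπ : ∀ x ∈ A, 0 ≤ π x)
    (hπ1 : ∑ x ∈ A, π x = 1) : regret A ω τ π ≤ regretBound A T α M :=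
  regret_le_of_forall ω hτ hπ hπ1 fun x _ => (sum_lagrangian_sub_le hM hτ hr x).trans h

lemma multLe_extend {M : ℝ} {T τ : ℕ} {ω : Fin T → Round} (hτ : τ ≤ T)
    (h : ∀ t : Fin T, t.val < τ → 0 ≤ mult (ω t) ∧ mult (ω t) ≤ M) :
    MultLe M (extend ω) τ := by
  intro t ht
  have := h ⟨t, by omega⟩ ht
  rwa [← extend_coe ω] at this

/-- The processes whose deviations are controlled. -/
def processes (A : Finset (I × I)) (η γ α M c₂ c₃ c₄ : ℝ) :
    (I × I) ⊕ Fin 3 → (n : ℕ) → (Fin n → Round) → Round → ℝ :=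
  Sum.elim (overProcess A η γ α M) ![underProcess A η γ α M c₂, sqProcess A η γ α M c₃,
    postedProcess A η γ α M c₄]

lemma measure_processes_le {A : Finset (I × I)} (hA : A.Nonempty) (η : ℝ)
    {γ α M c₂ c₃ c₄ : ℝ} (hγ : 0 < γ) (h0 : 0 < α) (h1 : α ≤ 1 / 2) (hc₂ : 0 ≤ c₂)
    (hc₃ : 0 ≤ c₃) (hc₃' : c₃ * ((2 * (2 * (1 + M)) ^ 2 + 2 / α) / γ) ≤ 1) (hc₄ : 0 ≤ c₄)
    (hc₄' : c₄ * (2 * (1 + M)) ≤ 1) (env : (n : ℕ) → Kernel (Fin n → Round) EnvMove)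
    (henv : ∀ n, IsMarkovKernel (env n)) (T : ℕ) (u : ℝ) :
    (law A η γ α env T).real
      {ω | ∃ τ ≤ T, MultLe M (extend ω) τ ∧ ∃ j ∈ A.disjSum (Finset.univ : Finset (Fin 3)),
        u < ∑ t ∈ Finset.range τ, processes A η γ α M c₂ c₃ c₄ j t (fun i => extend ω i)
          (extend ω t)} ≤ (T + 1) * ((A.card + 3 : ℕ) * Real.exp (-u)) := by
  have hα : α ≤ 1 := by linarith
  have := measure_exists_lt_sum_le hA η γ M h0.le hα env henv
    (A.disjSum (Finset.univ : Finset (Fin 3))) (F := processes A η γ α M c₂ c₃ c₄)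
    ?_ ?_ T u
  · rwa [Finset.card_disjSum, Finset.card_univ, Fintype.card_fin] at this
  · rintro (x | i) _ n
    · exact measurable_overProcess A η γ α M x n
    · fin_cases i
      · exact measurable_underProcess A η γ α M c₂ n
      · exact measurable_sqProcess A η γ α M c₃ n
      · exact measurable_postedProcess A η γ α M c₄ n
  · rintro (x | i) hj n h e he heM
    · exact lintegral_exp_overProcess_le_one η hγ h0 h1 (Finset.inl_mem_disjSum.1 hj) n h he heM
    · fin_cases i
      · exact lintegral_exp_underProcess_le_one hA η hγ h0 h1 hc₂ n h he heM
      · exact lintegral_exp_sqProcess_le_one hA η hγ h0 h1 hc₃ hc₃' n h he heM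
      · exact lintegral_exp_postedProcess_le_one hA η h0 hα hc₄ hc₄' n h he heM

lemma regret_le_of_tuned {A : Finset (I × I)} (hA : A.Nonempty) {T : ℕ} (hT : 2 ≤ T)
    {α M : ℝ} (h0 : 0 < α) (h1 : α ≤ 1) (hM : 1 ≤ M) (hAT : A.card ≤ T) {n q : ℝ}
    (hn : n = √(A.card : ℝ)) (hq : q = √(T : ℝ)) {ω : Fin T → Round} {τ : ℕ} (hτ : τ ≤ T)
    (hr : MultLe M (extend ω) τ)
    (hω : ∀ j ∈ A.disjSum (Finset.univ : Finset (Fin 3)), ∑ t ∈ Finset.range τ,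
      processes A (1 / (M * (n * q))) (1 / (n * q)) α M (1 / (M * q))
        (1 / (n * q) / (2 * (2 * (1 + M)) ^ 2 + 2 / α)) (1 / (2 * (1 + M) * q)) j t
        (fun i => extend ω i) (extend ω t) ≤ 4 * Real.log T)
    {π : I × I → ℝ} (hπ : ∀ x ∈ A, 0 ≤ π x) (hπ1 : ∑ x ∈ A, π x = 1) :
    regret A ω τ π ≤ regretBound A T α M := by
  have hN : (1 : ℝ) ≤ A.card := by exact_mod_cast hA.card_pos
  have hT1 : (1 : ℝ) ≤ T := by exact_mod_cast (by omega : 1 ≤ T)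
  have hn1 : 1 ≤ n := hn ▸ Real.one_le_sqrt.2 hN
  have hq1 : 1 ≤ q := hq ▸ Real.one_le_sqrt.2 hT1
  have hn2 : (A.card : ℝ) = n ^ 2 := by rw [hn, Real.sq_sqrt (by linarith)]
  have hq2 : (T : ℝ) = q ^ 2 := by rw [hq, Real.sq_sqrt (by linarith)]
  have hl : Real.log A.card ≤ Real.log T :=
    Real.log_le_log (by linarith) (by exact_mod_cast hAT)
  have hM0 : 0 < M := by linarith
  have hn0 : 0 < n := by linarith
  have hq0 : 0 < q := by linarith
  have hfin := tuned_bound_le hn1 hq1 (hn ▸ sqrt_card_le) h0 hM (half_le_log hT) hl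
  refine regret_le_of_forall ω hτ hπ hπ1 fun x hx => ?_
  refine (sum_lagrangian_sub_le_of_processes (A := A) (η := 1 / (M * (n * q)))
    (γ := 1 / (n * q)) (α := α) (u := 4 * Real.log T) (c₂ := 1 / (M * q))
    (c₃ := 1 / (n * q) / (2 * (2 * (1 + M)) ^ 2 + 2 / α)) (c₄ := 1 / (2 * (1 + M) * q))
    (by positivity) (by positivity) h0 h1 hM0.le (by positivity) (by positivity)
    (by positivity) hτ hr hx (hω (Sum.inl x) (Finset.inl_mem_disjSum.2 hx))
    (hω (Sum.inr 0) (Finset.inr_mem_disjSum.2 (Finset.mem_univ _)))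
    (hω (Sum.inr 1) (Finset.inr_mem_disjSum.2 (Finset.mem_univ _)))
    (hω (Sum.inr 2) (Finset.inr_mem_disjSum.2 (Finset.mem_univ _)))).trans ?_
  rw [regretBound, pow_one, Real.sqrt_mul (by linarith), ← hn, ← hq]
  refine le_trans (le_of_eq ?_) (hfin.trans (le_of_eq ?_))
  · simp only [biasBound, sqBound, ← hn2, ← hq2]
  · rw [← hq2]

end BilateralTrade

end

theorem mainTheorem2 :
    ∃ (C : ℝ) (k : ℕ), 0 < C ∧
      ∀ (A : Finset (unitInterval × unitInterval)) (T : ℕ) (α M : ℝ),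
        A.Nonempty → 2 ≤ T → 0 < α → α ≤ 1 → 1 ≤ M →
        ∃ η γ : ℝ, 0 < η ∧ 0 < γ ∧
          ∀ env : (n : ℕ) → ProbabilityTheory.Kernel (Fin n → BilateralTrade.Round)
              BilateralTrade.EnvMove,
            (∀ n, ProbabilityTheory.IsMarkovKernel (env n)) →
            (BilateralTrade.law A η γ α env T).real
              {ω | ¬ ∀ τ ≤ T,
                (∀ t : Fin T, t.val < τ →
                  0 ≤ BilateralTrade.mult (ω t) ∧ BilateralTrade.mult (ω t) ≤ M) →
                ∀ π : unitInterval × unitInterval → ℝ,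
                  (∀ x ∈ A, 0 ≤ π x) → ∑ x ∈ A, π x = 1 →
                  BilateralTrade.regret A ω τ π ≤
                    C * Real.log T ^ k *
                      (M * (√((A.card : ℝ) * T) +
                        (((BilateralTrade.sellerPrices A).card : ℝ) +
                            (BilateralTrade.buyerPrices A).card) / √(A.card : ℝ) *
                          (√(T : ℝ) / α) +
                        α * T))}
              ≤ C / T := by
  open BilateralTrade in
  refine ⟨500, 1, by norm_num, fun A T α M hA hT h0 h1 hM => ?_⟩
  have hN : (1 : ℝ) ≤ A.card := by exact_mod_cast hA.card_pos
  have hT2 : (2 : ℝ) ≤ T := by exact_mod_cast hT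
  have hn : 0 < √(A.card : ℝ) := Real.sqrt_pos.2 (by linarith)
  have hq : 0 < √(T : ℝ) := Real.sqrt_pos.2 (by linarith)
  have hM0 : 0 < M := by linarith
  -- `γ = 1 / √(|A| T)` balances the confidence cost `M log T / γ` against the bias `γ M |A| T`. `η
  -- = γ / M`, since the mean squared loss grows like `M²`.
  refine ⟨1 / (M * (√(A.card : ℝ) * √(T : ℝ))), 1 / (√(A.card : ℝ) * √(T : ℝ)), by positivity,
    by positivity, fun env henv => ?_⟩
  have := isProbabilityMeasure_law hA (1 / (M * (√(A.card : ℝ) * √(T : ℝ))))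
    (1 / (√(A.card : ℝ) * √(T : ℝ))) h0.le h1 env henv T
  -- The main argument uses `α ≤ 1/2` to keep `1 - α ≥ 1/2`, and `|A| ≤ T` for `log |A| ≤ log T` and
  -- the union bound. Otherwise the failure event is empty.
  by_cases htriv : 1 / 2 < α ∨ T ≤ A.card
  · refine le_trans (le_of_eq ?_) (show (0 : ℝ) ≤ 500 / T by positivity)
    convert measureReal_empty
    refine Set.eq_empty_of_forall_notMem fun ω hω => hω fun τ hτ hr π hπ hπ1 => ?_
    exact regret_le_of_trivial hM0.le (mul_le_regretBound_of_trivial hT h0 hM htriv) ω hτ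
      (multLe_extend hτ hr) hπ hπ1
  · obtain ⟨hα, hAT⟩ := not_or.1 htriv
    have hc : 0 < 2 * (2 * (1 + M)) ^ 2 + 2 / α := by positivity
    have hprob := measure_processes_le hA (1 / (M * (√(A.card : ℝ) * √(T : ℝ))))
      (γ := 1 / (√(A.card : ℝ) * √(T : ℝ))) (M := M) (c₂ := 1 / (M * √(T : ℝ)))
      (c₃ := 1 / (√(A.card : ℝ) * √(T : ℝ)) / (2 * (2 * (1 + M)) ^ 2 + 2 / α))
      (c₄ := 1 / (2 * (1 + M) * √(T : ℝ))) (by positivity) h0 (not_lt.1 hα) (by positivity)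
      (by positivity) (le_of_eq (by field_simp)) (by positivity) ?_ env henv T
      (4 * Real.log T)
    · refine (measureReal_mono (fun ω hω => ?_) (measure_ne_top _ _)).trans (hprob.trans ?_)
      · by_contra hcon
        refine hω fun τ hτ hr π hπ hπ1 => ?_
        refine regret_le_of_tuned hA hT h0 h1 hM (not_le.1 hAT).le rfl rfl hτ
          (multLe_extend hτ hr) (fun j hj => ?_) hπ hπ1
        by_contra hlt
        exact hcon ⟨τ, hτ, multLe_extend hτ hr, j, hj, not_le.1 hlt⟩
      -- With `u = 4 log T` the failure probability is at most `(T + 1)(|A| + 3) / T⁴ ≤ 8 / T²`.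
      · have e1 : Real.exp (-(4 * Real.log T)) = 1 / (T : ℝ) ^ 4 := by
          rw [Real.exp_neg, mul_comm, Real.exp_mul, Real.exp_log (by linarith), one_div]
          norm_cast
        have hAT' : (A.card : ℝ) ≤ T := by exact_mod_cast (not_le.1 hAT).le
        rw [e1, mul_one_div, mul_div_assoc', div_le_div_iff₀ (by positivity) (by linarith)]
        push_cast
        have a1 : ((T : ℝ) + 1) * (A.card + 3) ≤ (2 * T) * (4 * T) :=
          mul_le_mul (by linarith) (by linarith) (by positivity) (by positivity)
        have a2 := mul_le_mul_of_nonneg_right a1 (show (0 : ℝ) ≤ T by linarith)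
        have a3 : (T : ℝ) ^ 3 * 1 ≤ T ^ 3 * T :=
          mul_le_mul_of_nonneg_left (by linarith) (by positivity)
        have a4 : (0 : ℝ) ≤ T ^ 3 := by positivity
        linarith
    · have : 1 ≤ √(T : ℝ) := Real.one_le_sqrt.2 (by linarith)
      have h2 : 1 / (2 * (1 + M) * √(T : ℝ)) * (2 * (1 + M)) = 1 / √(T : ℝ) := by field_simp
      rw [h2]
      exact (div_le_one (by linarith)).2 this
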